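/- Endow $\mathbb C^2$ with the pseudo-Hermitian form $\langle\langle z,w\rangle\rangle_1=-z_1\bar w_1+z_2\bar w_2$, the metric $\langle\cdot,\cdot\rangle_2=\mathrm{Re}\,\langle\langle\cdot,\cdot\rangle\rangle_1$, the symplectic form $\omega_1=-\mathrm{Im}\,\langle\langle\cdot,\cdot\rangle\rangle_1$ and the complex structure $Jz=iz$. Let $M$ be a smooth surface ($C^\infty$, Hausdorff, second countable, without boundary) and let $f\colon M\to\mathbb C^2$ be a smooth immersion that is - Lagrangian, i.e. $f^*\omega_1=0$, and - minimal, i.e. the induced metric $f^*\langle\cdot,\cdot\rangle_2$ is non-degenerate at every point and $f$ is a critical point of the induced volume with respect to smooth compactly supported variations. Then for every connected component $M_0$ of $M$ there is a real two-dimensional linear subspace $P\subset\mathbb C^2$ which is totally null ($\langle X,Y\rangle_2=0$ for all $X,Y\in P$), neither Lagrangian ($\omega_1|_P\neq 0$) nor complex ($JP\neq P$), with $\mathbb C^2=P\oplus JP$, such that $M_0$ is locally a product $\gamma_1\times J\gamma_2\subset P\oplus JP$ of planar curves: every point of $M_0$ has a smooth chart $(u,v)$ of $M$ around it, onto an open rectangle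 $I_1\times I_2$, in which $$f(u,v)=\gamma_1(u)+J\gamma_2(v)$$ for smooth regular curves $\gamma_1\colon I_1\to P$ and $\gamma_2\colon I_2\to P$. -/

import Mathlib

open scoped Manifold ContDiff

noncomputable section

namespace LorentzianPlane

/-- The complex plane `ℂ²`, with coordinates `z 0 = z₁` and `z 1 = z₂`. -/
abbrev C2 : Type := Fin 2 → ℂ

/-- The parameter space `ℝ²` of a surface. -/
abbrev R2 : Type := EuclideanSpace ℝ (Fin 2)

/-- The pseudo-Hermitian form `⟪⟪z, w⟫⟫₁ = - z₁ w̄₁ + z₂ w̄₂`. -/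
def herm (z w : C2) : ℂ :=
  -(z 0 * (starRingEnd ℂ) (w 0)) + z 1 * (starRingEnd ℂ) (w 1)

/-- The neutral metric, the real part of the pseudo-Hermitian form. -/
def metric (z w : C2) : ℝ := (herm z w).re

/-- The symplectic form, minus the imaginary part of the pseudo-Hermitian form. -/
def omega (z w : C2) : ℝ := -(herm z w).im

/-- The complex structure `z ↦ i z`, as a real linear map. -/
def J : C2 →ₗ[ℝ] C2 where
  toFun z := Complex.I • z
  map_add' z w := smul_add _ z w
  map_smul' c z := smul_comm _ c z

/-- The induced metric on the real plane `P` vanishes. -/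
def IsTotallyNull (P : Submodule ℝ C2) : Prop :=
  ∀ X ∈ P, ∀ Y ∈ P, metric X Y = 0

/-- The symplectic form vanishes on the real plane `P`. -/
def IsLagrangianPlane (P : Submodule ℝ C2) : Prop :=
  ∀ X ∈ P, ∀ Y ∈ P, omega X Y = 0

/-- The real plane `P` is invariant under the complex structure. -/
def IsComplexPlane (P : Submodule ℝ C2) : Prop :=
  P.map J = P

section Surface

variable {M : Type*} [TopologicalSpace M] [ChartedSpace R2 M]

/-- `f` is a smooth immersion of the surface `M` in `ℂ²`. -/
def IsSmoothImmersion (f : M → C2) : Prop :=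
  ContMDiff (𝓡 2) 𝓘(ℝ, C2) ∞ f ∧
    ∀ x : M, Function.Injective (mfderiv (𝓡 2) 𝓘(ℝ, C2) f x)

/-- The pull-back of the metric by `f`, on the tangent space of `M` at `x`. -/
def inducedMetric (f : M → C2) (x : M) (X Y : TangentSpace (𝓡 2) x) : ℝ :=
  metric (mfderiv (𝓡 2) 𝓘(ℝ, C2) f x X) (mfderiv (𝓡 2) 𝓘(ℝ, C2) f x Y)

/-- The induced metric is non-degenerate at every point. -/
def IsNondegenerate (f : M → C2) : Prop :=
  ∀ (x : M) (X : TangentSpace (𝓡 2) x),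
    (∀ Y : TangentSpace (𝓡 2) x, inducedMetric f x X Y = 0) → X = 0

/-- The pull-back of the symplectic form by `f` vanishes. -/
def IsLagrangian (f : M → C2) : Prop :=
  ∀ (x : M) (X Y : TangentSpace (𝓡 2) x),
    omega (mfderiv (𝓡 2) 𝓘(ℝ, C2) f x X) (mfderiv (𝓡 2) 𝓘(ℝ, C2) f x Y) = 0

/-- The Gram matrix of the induced metric of `F` in the chart `e`, at the point `y` of the
target of `e`. -/
def gram (F : M → C2) (e : OpenPartialHomeomorph M R2) (y : R2) : Matrix (Fin 2) (Fin 2) ℝ :=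
  Matrix.of fun i j =>
    metric (fderiv ℝ (F ∘ e.symm) y (EuclideanSpace.single i 1))
      (fderiv ℝ (F ∘ e.symm) y (EuclideanSpace.single j 1))

/-- The volume `∫ √|det g|` for the metric induced by `F`, of a set `A` contained in the domain
of the chart `e`. -/
def chartVolume (F : M → C2) (e : OpenPartialHomeomorph M R2) (A : Set M) : ℝ :=
  ∫ y in e '' A, Real.sqrt |(gram F e y).det|

/-- A finite decomposition of a set `K` into disjoint Borel pieces, each contained in the domain
of a smooth chart. It serves to compute the volume of a compact set `K`, which does not depend
on the decomposition. -/
structure ChartDecomposition (K : Set M) where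
  /-- the number of pieces -/
  card : ℕ
  /-- the charts -/
  chart : Fin card → OpenPartialHomeomorph M R2
  /-- the pieces -/
  piece : Fin card → Set M
  chart_mem : ∀ i, chart i ∈ IsManifold.maximalAtlas (𝓡 2) ∞ M
  piece_subset : ∀ i, piece i ⊆ (chart i).source
  measurable : ∀ i, MeasurableSet (chart i '' piece i)
  disjoint : ∀ i j, i ≠ j → Disjoint (piece i) (piece j)
  iUnion_eq : ⋃ i, piece i = K

/-- The volume of `K` for the metric induced by `F`. -/
def ChartDecomposition.volume {K : Set M} (D : ChartDecomposition K) (F : M → C2) : ℝ :=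
  ∑ i, chartVolume F (D.chart i) (D.piece i)

/-- `F` is a smooth variation of `f` that moves no point outside of the set `K`. -/
def IsVariation (f : M → C2) (K : Set M) (F : ℝ → M → C2) : Prop :=
  ContMDiff (𝓘(ℝ, ℝ).prod (𝓡 2)) 𝓘(ℝ, C2) ∞ (fun p : ℝ × M => F p.1 p.2) ∧
    F 0 = f ∧ ∀ t : ℝ, ∀ x ∉ K, F t x = f x

/-- `f` is a critical point of the volume with respect to compactly supported variations. Since
the variation is fixed outside of the compact set `K`, only the volume of `K` matters. -/
def IsVolumeCritical (f : M → C2) : Prop :=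
  ∀ (K : Set M) (F : ℝ → M → C2), IsCompact K → IsVariation f K F →
    ∀ D : ChartDecomposition K, HasDerivAt (fun t : ℝ => D.volume (F t)) 0 0

/-- Minimal immersions: non-degenerate and critical for the volume. -/
def IsMinimal (f : M → C2) : Prop :=
  IsNondegenerate f ∧ IsVolumeCritical f

/-- Near `x`, the surface is the product of two regular curves `γ₁` and `J γ₂`, where `γ₁` and
`γ₂` lie in `P`: some smooth chart around `x` maps onto a rectangle, in which `f` is
`(u, v) ↦ γ₁ u + J (γ₂ v)`. -/
def IsLocalProductAt (f : M → C2) (P : Submodule ℝ C2) (x : M) : Prop :=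
  ∃ (a b c d : ℝ) (γ₁ γ₂ : ℝ → C2) (e : OpenPartialHomeomorph M R2),
    ContDiffOn ℝ ∞ γ₁ (Set.Ioo a b) ∧ ContDiffOn ℝ ∞ γ₂ (Set.Ioo c d) ∧
    (∀ u ∈ Set.Ioo a b, deriv γ₁ u ≠ 0) ∧ (∀ v ∈ Set.Ioo c d, deriv γ₂ v ≠ 0) ∧
    (∀ u ∈ Set.Ioo a b, γ₁ u ∈ P) ∧ (∀ v ∈ Set.Ioo c d, γ₂ v ∈ P) ∧
    e ∈ IsManifold.maximalAtlas (𝓡 2) ∞ M ∧ x ∈ e.source ∧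
    e.target = {y : R2 | y 0 ∈ Set.Ioo a b ∧ y 1 ∈ Set.Ioo c d} ∧
    ∀ y ∈ e.target, f (e.symm y) = γ₁ (y 0) + J (γ₂ (y 1))

end Surface

end LorentzianPlane

end

/-! In a chart write `X`, `Y` for the partial derivatives of `f` and `D` for their complex
determinant. The Gram determinant is `ω(X,Y)² - |D|²` (`metric_mul_metric_sub`), so the area density
of a Lagrangian surface is `|D|`. Under a variation `f + tφw` with a constant vector `w`, the term
in `ω` enters only at order `t²`. The first variation is therefore that of `∫ |D|`, even though the
varied surfaces need not be Lagrangian. Integrating by parts and letting `φ` and `w` vary shows that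
the phase `D̄/|D|` is locally constant (`fderiv_phase_eq_zero`).

Fix a unit `c` with `c̄D` real and split `z` into `A = z₁ + c z̄₂` and `B = z₁ - c z̄₂`, the
components along a null plane `P` and along `JP`. The sum and the difference of `Im (A Ā')` and `Im
(B B̄')` are `2ω` and `2 Im (c̄ det)` (`omega_eq_null`, `detC_eq_null`). Both vanish on the surface,
so `A ∘ df` and `B ∘ df` each have real rank at most one. The metric pairs `A` only with `B`
(`metric_eq_null`), so non-degeneracy makes both ranks one, with independent kernels. Real
coordinates extracted from `A ∘ f` and `B ∘ f` then form a chart in which `A ∘ f` depends on one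
variable and `B ∘ f` on the other (`exists_product_chart`).

The plane depends only on `c`, and the condition that `c̄D` be real is independent of the chart and
defines a clopen set (`isClopen_phaseSet`). One plane thus serves the whole component. -/

open scoped Manifold ContDiff

noncomputable section

namespace LorentzianPlane

/-! ### Algebra of the Gram determinant -/

/-- The complex determinant of two vectors of `ℂ²`. -/
def detC (z w : C2) : ℂ := z 0 * w 1 - z 1 * w 0

theorem J_apply (z : C2) (i : Fin 2) : J z i = Complex.I * z i := rfl

/-- The Gram determinant of two vectors in terms of the symplectic form and the complex
determinant. -/
theorem metric_mul_metric_sub (X Y : C2) :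
    metric X X * metric Y Y - metric X Y * metric Y X
      = omega X Y ^ 2 - Complex.normSq (detC X Y) := by
  simp only [metric, omega, herm, detC, Complex.normSq_apply, Complex.add_re, Complex.add_im,
    Complex.neg_re, Complex.neg_im, Complex.mul_re, Complex.mul_im, Complex.conj_re,
    Complex.conj_im, Complex.sub_re, Complex.sub_im]
  ring

theorem metric_add_left (X Y Z : C2) : metric (X + Y) Z = metric X Z + metric Y Z := by
  simp only [metric, herm, Pi.add_apply, Complex.add_re, Complex.neg_re, Complex.mul_re,
    Complex.conj_re, Complex.conj_im, Complex.add_im]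
  ring

theorem metric_smul_left (a : ℝ) (X Z : C2) : metric (a • X) Z = a * metric X Z := by
  simp only [metric, herm, Pi.smul_apply, Complex.add_re, Complex.neg_re, Complex.mul_re,
    Complex.conj_re, Complex.conj_im, Complex.smul_re, Complex.smul_im, smul_eq_mul]
  ring

theorem metric_comm (X Y : C2) : metric X Y = metric Y X := by
  simp only [metric, herm, Complex.add_re, Complex.neg_re, Complex.mul_re,
    Complex.conj_re, Complex.conj_im]
  ring

theorem omega_add_smul (X Y w : C2) (a b t : ℝ) :
    omega (X + (t * a) • w) (Y + (t * b) • w)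
      = omega X Y + t * (a * omega w Y + b * omega X w) := by
  simp only [omega, herm, Pi.smul_apply, Pi.add_apply, Complex.add_im, Complex.neg_im,
    Complex.mul_im, Complex.conj_re, Complex.conj_im, Complex.smul_re, Complex.smul_im,
    smul_eq_mul, Complex.add_re]
  ring

theorem detC_add_smul (X Y w : C2) (a b t : ℝ) :
    detC (X + (t * a) • w) (Y + (t * b) • w)
      = detC X Y + t * (a * detC w Y + b * detC X w) := by
  simp only [detC, Pi.smul_apply, Pi.add_apply, Complex.real_smul, Complex.ofReal_mul]
  ring

theorem detC_smul_add_smul (X Y : C2) (a b c d : ℝ) :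
    detC (a • X + b • Y) (c • X + d • Y) = ((a * d - b * c : ℝ) : ℂ) * detC X Y := by
  simp only [detC, Pi.smul_apply, Pi.add_apply, Complex.real_smul, Complex.ofReal_mul,
    Complex.ofReal_sub]
  ring

theorem normSq_add_ofReal_mul (z w : ℂ) (t : ℝ) :
    Complex.normSq (z + t * w) = Complex.normSq z + t * (2 * ((starRingEnd ℂ) z * w).re)
      + t ^ 2 * Complex.normSq w := by
  simp only [Complex.normSq_apply, Complex.add_re, Complex.add_im, Complex.mul_re, Complex.mul_im,
    Complex.ofReal_re, Complex.ofReal_im, Complex.conj_re, Complex.conj_im]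
  ring

/-- The absolute Gram determinant along an affine deformation of a Lagrangian frame. -/
theorem abs_metric_det_add_smul {X Y : C2} (h : omega X Y = 0) (w : C2) (a b t : ℝ) :
    |metric (X + (t * a) • w) (X + (t * a) • w) * metric (Y + (t * b) • w) (Y + (t * b) • w)
      - metric (X + (t * a) • w) (Y + (t * b) • w) * metric (Y + (t * b) • w) (X + (t * a) • w)|
      = |Complex.normSq (detC X Y)
        + t * (2 * ((starRingEnd ℂ) (detC X Y) * (a * detC w Y + b * detC X w)).re)
        + t ^ 2 * (Complex.normSq (a * detC w Y + b * detC X w)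
          - (a * omega w Y + b * omega X w) ^ 2)| := by
  -- The Gram determinant is `-|D|²` at `t = 0`; changing the sign inside the absolute value makes
  -- the constant term non-negative.
  rw [metric_mul_metric_sub, omega_add_smul, detC_add_smul, normSq_add_ofReal_mul, h, ← abs_neg]
  congr 1
  ring

/-- If `s Y - t X` is annihilated by the real part of the determinant, then `s = t = 0`. -/
theorem eq_zero_of_re_detC {X Y : C2} (hD : detC X Y ≠ 0) {s t : ℂ}
    (h : ∀ w : C2, (s * detC w Y + t * detC X w).re = 0) : s = 0 ∧ t = 0 := by
  -- The expression is complex linear in `w`, so testing `i w` recovers the imaginary part.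
  have h' : ∀ w : C2, s * detC w Y + t * detC X w = 0 := by
    intro w
    refine Complex.ext (h w) ?_
    have := h (Complex.I • w)
    have e : s * detC (Complex.I • w) Y + t * detC X (Complex.I • w)
        = Complex.I * (s * detC w Y + t * detC X w) := by
      simp only [detC, Pi.smul_apply, smul_eq_mul]; ring
    rw [e] at this
    simp only [Complex.mul_re, Complex.I_re, Complex.I_im, zero_mul, one_mul, zero_sub,
      neg_eq_zero] at this
    simpa only [Complex.zero_im] using this
  constructor
  · have := h' X
    have e : detC X X = 0 := by simp only [detC]; ring
    simpa [e, hD] using this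
  · have := h' Y
    have e : detC Y Y = 0 := by simp only [detC]; ring
    simpa [e, hD] using this


/-! ### Differentiation under the integral and integration by parts -/

open MeasureTheory Filter Topology in
/-- Differentiation of `∫ √|A + t B + t² C|` over a compact set on which `A` is positive. -/
theorem hasDerivAt_integral_sqrt {E : Type*} [TopologicalSpace E] [T2Space E] [MeasurableSpace E]
    [BorelSpace E] [SecondCountableTopology E]
    {μ : Measure E} [IsFiniteMeasureOnCompacts μ] {K : Set E} (hK : IsCompact K)
    {A B C : E → ℝ} (hA : ContinuousOn A K) (hB : ContinuousOn B K) (hC : ContinuousOn C K)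
    (hpos : ∀ y ∈ K, 0 < A y) :
    HasDerivAt (fun t : ℝ => ∫ y in K, Real.sqrt |A y + t * B y + t ^ 2 * C y| ∂μ)
      (∫ y in K, B y / (2 * Real.sqrt (A y)) ∂μ) 0 := by
  obtain ⟨δ, hδ, hAδ⟩ : ∃ δ > 0, ∀ y ∈ K, δ ≤ A y := by
    rcases K.eq_empty_or_nonempty with rfl | hne
    · exact ⟨1, one_pos, by simp⟩
    · obtain ⟨y, hy, hmin⟩ := hK.exists_isMinOn hne hA
      exact ⟨A y, hpos y hy, fun z hz => hmin hz⟩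
  obtain ⟨b, hb⟩ := hK.exists_bound_of_continuousOn hB
  obtain ⟨c, hc⟩ := hK.exists_bound_of_continuousOn hC
  set m : ℝ := max (max b c) 1 with hm
  have hm1 : 1 ≤ m := le_max_right _ _
  have hBm : ∀ y ∈ K, |B y| ≤ m := fun y hy =>
    (hb y hy).trans ((le_max_left _ _).trans (le_max_left _ _))
  have hCm : ∀ y ∈ K, |C y| ≤ m := fun y hy =>
    (hc y hy).trans ((le_max_right _ _).trans (le_max_left _ _))
  -- For `|t| < ε` the terms `tB` and `t²C` are each at most `δ/4` in absolute value, which leaves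
  -- the radicand at least `δ/2`.
  set ε : ℝ := min 1 (δ / (4 * m)) with hε
  have hε0 : 0 < ε := lt_min one_pos (by positivity)
  have hlow : ∀ y ∈ K, ∀ t ∈ Metric.ball (0 : ℝ) ε, δ / 2 ≤ A y + t * B y + t ^ 2 * C y := by
    intro y hy t ht
    rw [Metric.mem_ball, dist_zero_right, Real.norm_eq_abs] at ht
    have ht1 : |t| ≤ 1 := ht.le.trans (min_le_left _ _)
    have ht2 : |t| * m ≤ δ / 4 := by
      have := ht.le.trans (min_le_right _ _)
      calc |t| * m ≤ δ / (4 * m) * m := by gcongr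
        _ = δ / 4 := by field_simp
    have h1 : |t * B y| ≤ δ / 4 := by
      rw [abs_mul]
      exact (mul_le_mul_of_nonneg_left (hBm y hy) (abs_nonneg t)).trans ht2
    have h2 : |t ^ 2 * C y| ≤ δ / 4 := by
      rw [abs_mul, abs_pow]
      calc |t| ^ 2 * |C y| ≤ (|t| * 1) * m := by
            rw [sq]; gcongr; exact hCm y hy
        _ ≤ δ / 4 := by rw [mul_one]; exact ht2
    have := hAδ y hy
    have := (abs_le.1 h1).1
    have := (abs_le.1 h2).1
    linarith
  have hcont : ∀ t : ℝ, ContinuousOn (fun y => Real.sqrt |A y + t * B y + t ^ 2 * C y|) K :=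
    fun t => ((hA.add (continuousOn_const.mul hB)).add (continuousOn_const.mul hC)).abs.sqrt
  have hmeas : MeasurableSet K := hK.measurableSet
  have key := hasDerivAt_integral_of_dominated_loc_of_deriv_le (𝕜 := ℝ) (μ := μ.restrict K)
    (F := fun t y => Real.sqrt |A y + t * B y + t ^ 2 * C y|)
    (F' := fun t y => (B y + 2 * t * C y) / (2 * Real.sqrt (A y + t * B y + t ^ 2 * C y)))
    (x₀ := 0) (s := Metric.ball 0 ε) (bound := fun _ => (3 * m) / (2 * Real.sqrt (δ / 2)))
    (Metric.ball_mem_nhds _ hε0)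
    (Eventually.of_forall fun t => (hcont t).aestronglyMeasurable hmeas)
    ((hcont 0).integrableOn_compact hK) ?_ ?_ ?_ ?_
  · simpa using key.2
  · refine ContinuousOn.aestronglyMeasurable ?_ hmeas
    refine (hB.add (continuousOn_const.mul hC)).div
      (continuousOn_const.mul
        ((hA.add (continuousOn_const.mul hB)).add (continuousOn_const.mul hC)).sqrt) ?_
    intro y hy
    have := hlow y hy 0 (Metric.mem_ball_self hε0)
    have : 0 < A y + 0 * B y + 0 ^ 2 * C y := by linarith
    positivity
  · refine (ae_restrict_iff' hmeas).2 (Eventually.of_forall fun y hy t ht => ?_)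
    have hl := hlow y hy t ht
    rw [Metric.mem_ball, dist_zero_right, Real.norm_eq_abs] at ht
    have ht1 : |t| ≤ 1 := ht.le.trans (min_le_left _ _)
    have hnum : |B y + 2 * t * C y| ≤ 3 * m := by
      refine (abs_add_le _ _).trans ?_
      have h2 : |2 * t * C y| ≤ 2 * 1 * m := by
        rw [abs_mul, abs_mul, abs_two]
        gcongr
        exact hCm y hy
      have := hBm y hy
      linarith
    have hs : Real.sqrt (δ / 2) ≤ Real.sqrt (A y + t * B y + t ^ 2 * C y) := Real.sqrt_le_sqrt hl
    have hs0 : 0 < Real.sqrt (δ / 2) := Real.sqrt_pos.2 (by positivity)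
    rw [Real.norm_eq_abs, abs_div, abs_of_nonneg (by positivity :
      0 ≤ 2 * Real.sqrt (A y + t * B y + t ^ 2 * C y))]
    gcongr
  · exact integrableOn_const hK.measure_lt_top.ne
  · refine (ae_restrict_iff' hmeas).2 (Eventually.of_forall fun y hy t ht => ?_)
    have hev : (fun s => Real.sqrt (A y + s * B y + s ^ 2 * C y)) =ᶠ[𝓝 t]
        fun s => Real.sqrt |A y + s * B y + s ^ 2 * C y| := by
      filter_upwards [Metric.isOpen_ball.mem_nhds ht] with s hs
      rw [abs_of_nonneg ((by positivity : 0 ≤ δ / 2).trans (hlow y hy s hs))]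
    refine HasDerivAt.congr_of_eventuallyEq ?_ hev.symm
    have hl := hlow y hy t ht
    have h1 : HasDerivAt (fun s : ℝ => A y + s * B y + s ^ 2 * C y) (B y + 2 * t * C y) t := by
      have := (((hasDerivAt_id t).mul_const (B y)).const_add (A y)).add
        (((hasDerivAt_id t).pow 2).mul_const (C y))
      exact this.congr_deriv (by simp)
    exact h1.sqrt (by linarith : (0 : ℝ) < _).ne'

open MeasureTheory in
/-- Integration by parts against a compactly supported test function. -/
theorem integral_fderiv_mul_eq {φ p : R2 → ℝ} {U : Set R2} (hU : IsOpen U)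
    (hφ : ContDiff ℝ ∞ φ) (hφc : HasCompactSupport φ) (hφU : tsupport φ ⊆ U)
    (hp : ContDiffOn ℝ ∞ p U) (v : R2) :
    Integrable (fun y => fderiv ℝ φ y v * p y) ∧ Integrable (fun y => φ y * fderiv ℝ p y v) ∧
    ∫ y, fderiv ℝ φ y v * p y = - ∫ y, φ y * fderiv ℝ p y v := by
  have hp' : ContinuousOn (fun y => fderiv ℝ p y v) U :=
    (hp.continuousOn_fderiv_of_isOpen hU (by simp)).clm_apply continuousOn_const
  have hφ' : Continuous (fun y => fderiv ℝ φ y v) :=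
    (hφ.continuous_fderiv (by simp)).clm_apply continuous_const
  have aux : ∀ {a b : R2 → ℝ}, Continuous a → tsupport a ⊆ tsupport φ → ContinuousOn b U →
      Integrable (fun y => a y * b y) := by
    intro a b ha hs hb
    have hc : HasCompactSupport a := hφc.of_isClosed_subset (isClosed_tsupport a) hs
    have hco : Continuous (fun y => a y * b y) := by
      -- `b` is controlled only on `U`, but the product needs checking only on its own support,
      -- which lies in `U`.
      refine continuous_of_tsupport fun y hy => ?_
      have hy' : y ∈ U := hφU (hs (tsupport_mul_subset_left hy))
      exact ha.continuousAt.mul (hb.continuousAt (hU.mem_nhds hy'))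
    exact hco.integrable_of_hasCompactSupport (hc.mul_right)
  have hs' : tsupport (fun y => fderiv ℝ φ y v) ⊆ tsupport φ :=
    tsupport_fderiv_apply_subset ℝ v
  have h1 := aux hφ' hs' hp.continuousOn
  have h2 := aux hφ.continuous subset_rfl hp'
  have h3 := aux hφ.continuous subset_rfl hp.continuousOn
  refine ⟨h1, h2, ?_⟩
  have := integral_mul_fderiv_eq_neg_fderiv_mul_of_integrable (μ := volume) (v := v) h1 h2 h3
    (fun x _ => hφ.differentiable (by simp) x)
    (fun x hx => (hp.differentiableOn (by simp)).differentiableAt (hU.mem_nhds (hφU hx)))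
  rw [this, neg_neg]


/-! ### The Euler-Lagrange equation in a parameter domain -/

/-- The partial derivative of `g` in the `i`-th coordinate direction. -/
def partialD (g : R2 → C2) (i : Fin 2) (y : R2) : C2 :=
  fderiv ℝ g y (EuclideanSpace.single i 1)

/-- The complex Jacobian determinant of `g : ℝ² → ℂ²`. -/
def jacobian (g : R2 → C2) (y : R2) : ℂ := detC (partialD g 0 y) (partialD g 1 y)

/-- The conjugate of the phase of the complex Jacobian determinant. -/
def phase (g : R2 → C2) (y : R2) : ℂ :=
  (Real.sqrt (Complex.normSq (jacobian g y)))⁻¹ • (starRingEnd ℂ) (jacobian g y)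

/-- The Gram determinant of the metric induced by `g : ℝ² → ℂ²`. -/
def gramDet (g : R2 → C2) (y : R2) : ℝ :=
  metric (partialD g 0 y) (partialD g 0 y) * metric (partialD g 1 y) (partialD g 1 y)
    - metric (partialD g 0 y) (partialD g 1 y) * metric (partialD g 1 y) (partialD g 0 y)

section

variable {U : Set R2} {g : R2 → C2}

theorem contDiffOn_partialD (hU : IsOpen U) (hg : ContDiffOn ℝ ∞ g U) (i : Fin 2) :
    ContDiffOn ℝ ∞ (partialD g i) U :=
  (hg.fderiv_of_isOpen hU (by simp)).clm_apply contDiffOn_const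

theorem ContDiffOn.detC {E : Type*} [NormedAddCommGroup E] [NormedSpace ℝ E] {s : Set E}
    {X Y : E → C2} (hX : ContDiffOn ℝ ∞ X s)
    (hY : ContDiffOn ℝ ∞ Y s) : ContDiffOn ℝ ∞ (fun y => detC (X y) (Y y)) s := by
  have hX' := contDiffOn_pi.1 hX
  have hY' := contDiffOn_pi.1 hY
  exact ((hX' 0).mul (hY' 1)).sub ((hX' 1).mul (hY' 0))

theorem ContinuousOn.detC {E : Type*} [TopologicalSpace E] {s : Set E} {X Y : E → C2}
    (hX : ContinuousOn X s) (hY : ContinuousOn Y s) :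
    ContinuousOn (fun y => detC (X y) (Y y)) s := by
  have hX' := continuousOn_pi.1 hX
  have hY' := continuousOn_pi.1 hY
  exact ((hX' 0).mul (hY' 1)).sub ((hX' 1).mul (hY' 0))

theorem ContinuousOn.omega {E : Type*} [TopologicalSpace E] {s : Set E} {X Y : E → C2}
    (hX : ContinuousOn X s) (hY : ContinuousOn Y s) :
    ContinuousOn (fun y => omega (X y) (Y y)) s := by
  have hX' := continuousOn_pi.1 hX
  have hY' := fun i => Complex.continuous_conj.comp_continuousOn (continuousOn_pi.1 hY i)
  exact (Complex.continuous_im.comp_continuousOn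
    (((hX' 0).mul (hY' 0)).neg.add ((hX' 1).mul (hY' 1)))).neg

theorem contDiffOn_re {E : Type*} [NormedAddCommGroup E] [NormedSpace ℝ E] {s : Set E}
    {h : E → ℂ} (hh : ContDiffOn ℝ ∞ h s) :
    ContDiffOn ℝ ∞ (fun y => (h y).re) s :=
  Complex.reCLM.contDiff.comp_contDiffOn hh

theorem contDiffOn_im {E : Type*} [NormedAddCommGroup E] [NormedSpace ℝ E] {s : Set E}
    {h : E → ℂ} (hh : ContDiffOn ℝ ∞ h s) :
    ContDiffOn ℝ ∞ (fun y => (h y).im) s :=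
  Complex.imCLM.contDiff.comp_contDiffOn hh

theorem contDiffOn_normSq {E : Type*} [NormedAddCommGroup E] [NormedSpace ℝ E] {s : Set E}
    {h : E → ℂ} (hh : ContDiffOn ℝ ∞ h s) :
    ContDiffOn ℝ ∞ (fun y => Complex.normSq (h y)) s := by
  simp only [Complex.normSq_apply]
  exact ((contDiffOn_re hh).mul (contDiffOn_re hh)).add ((contDiffOn_im hh).mul (contDiffOn_im hh))

theorem contDiffOn_jacobian (hU : IsOpen U) (hg : ContDiffOn ℝ ∞ g U) :
    ContDiffOn ℝ ∞ (jacobian g) U :=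
  ContDiffOn.detC (contDiffOn_partialD hU hg 0) (contDiffOn_partialD hU hg 1)

theorem contDiffOn_phase (hU : IsOpen U) (hg : ContDiffOn ℝ ∞ g U)
    (hD : ∀ y ∈ U, jacobian g y ≠ 0) : ContDiffOn ℝ ∞ (phase g) U := by
  have hJ := contDiffOn_jacobian hU hg
  refine ContDiffOn.smul (ContDiffOn.inv (ContDiffOn.sqrt (contDiffOn_normSq hJ) ?_) ?_)
    (Complex.conjCLE.contDiff.comp_contDiffOn hJ)
  · intro y hy
    exact (Complex.normSq_pos.2 (hD y hy)).ne'
  · intro y hy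
    exact (Real.sqrt_pos.2 (Complex.normSq_pos.2 (hD y hy))).ne'

theorem partialD_add_smul {φ : R2 → ℝ} {y : R2} (hg : DifferentiableAt ℝ g y)
    (hφ : DifferentiableAt ℝ φ y) (t : ℝ) (w : C2) (i : Fin 2) :
    partialD (fun y => g y + (t * φ y) • w) i y
      = partialD g i y + (t * fderiv ℝ φ y (EuclideanSpace.single i 1)) • w := by
  have h := hg.hasFDerivAt.add ((hφ.hasFDerivAt.const_mul t).smul_const w)
  have h' : HasFDerivAt (fun y => g y + (t * φ y) • w) _ y := h
  rw [partialD, h'.fderiv]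
  simp [partialD]

/-- Symmetry of the second derivative. It removes the second derivatives of `g` from the
Euler-Lagrange equation. -/
theorem fderiv_partialD_comm (hU : IsOpen U) (hg : ContDiffOn ℝ ∞ g U) {y : R2} (hy : y ∈ U) :
    fderiv ℝ (partialD g 1) y (EuclideanSpace.single 0 1)
      = fderiv ℝ (partialD g 0) y (EuclideanSpace.single 1 1) := by
  have hs := (hg.contDiffAt (hU.mem_nhds hy)).isSymmSndFDerivAt
    (by simpa using WithTop.coe_le_coe.2 (le_top : (2 : ℕ∞) ≤ ⊤))
  have hd : DifferentiableAt ℝ (fderiv ℝ g) y :=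
    ((hg.fderiv_of_isOpen (m := ∞) hU (by simp)).differentiableOn (by simp)).differentiableAt
      (hU.mem_nhds hy)
  have key : ∀ i v, fderiv ℝ (partialD g i) y v
      = fderiv ℝ (fderiv ℝ g) y v (EuclideanSpace.single i 1) := by
    intro i v
    have h' : HasFDerivAt (partialD g i) _ y :=
      hd.hasFDerivAt.clm_apply (hasFDerivAt_const (EuclideanSpace.single i (1 : ℝ)) y)
    rw [h'.fderiv]
    simp
  rw [key, key]
  exact hs.eq _ _

theorem fderiv_re_mul_detC {τ : R2 → ℂ} {X Y : R2 → C2} {y : R2}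
    (hτ : DifferentiableAt ℝ τ y) (hX : DifferentiableAt ℝ X y) (hY : DifferentiableAt ℝ Y y)
    (v : R2) :
    fderiv ℝ (fun y => (τ y * detC (X y) (Y y)).re) y v
      = (fderiv ℝ τ y v * detC (X y) (Y y) + τ y * detC (fderiv ℝ X y v) (Y y)
          + τ y * detC (X y) (fderiv ℝ Y y v)).re := by
  have hX' := hasFDerivAt_pi'.1 hX.hasFDerivAt
  have hY' := hasFDerivAt_pi'.1 hY.hasFDerivAt
  have h : HasFDerivAt (fun y => (τ y * detC (X y) (Y y)).re) _ y :=
    Complex.reCLM.hasFDerivAt.comp y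
      (hτ.hasFDerivAt.mul (((hX' 0).mul (hY' 1)).sub ((hX' 1).mul (hY' 0))))
  rw [h.fderiv]
  simp [detC]
  ring

open MeasureTheory in
/-- The first variation of the volume at a Lagrangian surface in `ℂ²`. -/
theorem hasDerivAt_integral_sqrt_gramDet (hU : IsOpen U) (hg : ContDiffOn ℝ ∞ g U)
    (hD : ∀ y ∈ U, jacobian g y ≠ 0) (hω : ∀ y ∈ U, omega (partialD g 0 y) (partialD g 1 y) = 0)
    {φ : R2 → ℝ} (hφ : ContDiff ℝ ∞ φ) (hφc : HasCompactSupport φ) (hφU : tsupport φ ⊆ U)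
    (w : C2) :
    HasDerivAt (fun t : ℝ => ∫ y in tsupport φ,
        Real.sqrt |gramDet (fun y => g y + (t * φ y) • w) y|)
      (∫ y in tsupport φ, 2 * ((starRingEnd ℂ) (jacobian g y) *
        (fderiv ℝ φ y (EuclideanSpace.single 0 1) * detC w (partialD g 1 y)
          + fderiv ℝ φ y (EuclideanSpace.single 1 1) * detC (partialD g 0 y) w)).re
        / (2 * Real.sqrt (Complex.normSq (jacobian g y)))) 0 := by
  have hX := contDiffOn_partialD hU hg 0
  have hY := contDiffOn_partialD hU hg 1
  set X := partialD g 0 with hXdef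
  set Y := partialD g 1 with hYdef
  set e0 : R2 := EuclideanSpace.single 0 1
  set e1 : R2 := EuclideanSpace.single 1 1
  have hφd : ∀ y, DifferentiableAt ℝ φ y := fun y => hφ.differentiable (by simp) y
  have hφ' : ∀ v, Continuous fun y => fderiv ℝ φ y v := fun v =>
    (hφ.continuous_fderiv (by simp)).clm_apply continuous_const
  set D₁ : R2 → ℂ := fun y => fderiv ℝ φ y e0 * detC w (Y y) + fderiv ℝ φ y e1 * detC (X y) w
  have hJc : ContinuousOn (jacobian g) (tsupport φ) :=
    (contDiffOn_jacobian hU hg).continuousOn.mono hφU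
  have hXc' : ContinuousOn X (tsupport φ) := hX.continuousOn.mono hφU
  have hYc' : ContinuousOn Y (tsupport φ) := hY.continuousOn.mono hφU
  have hφ0 : ∀ v, ContinuousOn (fun y => fderiv ℝ φ y v) (tsupport φ) := fun v =>
    (hφ' v).continuousOn
  have hφ0' : ∀ v, ContinuousOn (fun y => (fderiv ℝ φ y v : ℂ)) (tsupport φ) := fun v =>
    (Complex.continuous_ofReal.comp (hφ' v)).continuousOn
  have hw : ContinuousOn (fun _ : R2 => w) (tsupport φ) := continuousOn_const
  have hd1 : ContinuousOn (fun y => detC w (Y y)) (tsupport φ) := ContinuousOn.detC hw hYc'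
  have hd2 : ContinuousOn (fun y => detC (X y) w) (tsupport φ) := ContinuousOn.detC hXc' hw
  have ho1 : ContinuousOn (fun y => omega w (Y y)) (tsupport φ) := ContinuousOn.omega hw hYc'
  have ho2 : ContinuousOn (fun y => omega (X y) w) (tsupport φ) := ContinuousOn.omega hXc' hw
  have hD₁c : ContinuousOn D₁ (tsupport φ) := by
    exact ((hφ0' e0).mul hd1).add ((hφ0' e1).mul hd2)
  have hωc : ContinuousOn (fun y => fderiv ℝ φ y e0 * omega w (Y y)
      + fderiv ℝ φ y e1 * omega (X y) w) (tsupport φ) :=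
    ((hφ0 e0).mul ho1).add ((hφ0 e1).mul ho2)
  have hder := hasDerivAt_integral_sqrt (μ := (volume : Measure R2)) (K := tsupport φ) hφc
    (A := fun y => Complex.normSq (jacobian g y))
    (B := fun y => 2 * ((starRingEnd ℂ) (jacobian g y) * D₁ y).re)
    (C := fun y => Complex.normSq (D₁ y) - (fderiv ℝ φ y e0 * omega w (Y y)
      + fderiv ℝ φ y e1 * omega (X y) w) ^ 2)
    (Complex.continuous_normSq.comp_continuousOn hJc)
    (continuousOn_const.mul (Complex.continuous_re.comp_continuousOn
      ((Complex.continuous_conj.comp_continuousOn hJc).mul hD₁c)))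
    ((Complex.continuous_normSq.comp_continuousOn hD₁c).sub (hωc.pow 2))
    (fun y hy => Complex.normSq_pos.2 (hD y (hφU hy)))
  have hsame : (fun t : ℝ => ∫ y in tsupport φ,
        Real.sqrt |gramDet (fun y => g y + (t * φ y) • w) y|)
      = fun t : ℝ => ∫ y in tsupport φ, Real.sqrt |Complex.normSq (jacobian g y)
        + t * (2 * ((starRingEnd ℂ) (jacobian g y) * D₁ y).re)
        + t ^ 2 * (Complex.normSq (D₁ y) - (fderiv ℝ φ y e0 * omega w (Y y)
          + fderiv ℝ φ y e1 * omega (X y) w) ^ 2)| := by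
    funext t
    refine setIntegral_congr_fun (isClosed_tsupport φ).measurableSet fun y hy => ?_
    have hgd : DifferentiableAt ℝ g y :=
      (hg.differentiableOn (by simp)).differentiableAt (hU.mem_nhds (hφU hy))
    simp only [gramDet, partialD_add_smul hgd (hφd y)]
    rw [abs_metric_det_add_smul (hω y (hφU hy))]
    rfl
  rw [hsame]
  exact hder

open MeasureTheory in
/-- The Euler-Lagrange equation of the volume at a Lagrangian surface in `ℂ²`: the phase of the
complex Jacobian determinant is locally constant. -/
theorem fderiv_phase_eq_zero (hU : IsOpen U) (hg : ContDiffOn ℝ ∞ g U)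
    (hD : ∀ y ∈ U, jacobian g y ≠ 0) (hω : ∀ y ∈ U, omega (partialD g 0 y) (partialD g 1 y) = 0)
    (hcrit : ∀ (φ : R2 → ℝ), ContDiff ℝ ∞ φ → HasCompactSupport φ → tsupport φ ⊆ U →
      ∀ w : C2, HasDerivAt (fun t : ℝ => ∫ y in tsupport φ,
        Real.sqrt |gramDet (fun y => g y + (t * φ y) • w) y|) 0 0) :
    ∀ y ∈ U, fderiv ℝ (phase g) y = 0 := by
  have hX := contDiffOn_partialD hU hg 0
  have hY := contDiffOn_partialD hU hg 1
  have hτ := contDiffOn_phase hU hg hD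
  set X := partialD g 0 with hXdef
  set Y := partialD g 1 with hYdef
  set e0 : R2 := EuclideanSpace.single 0 1
  set e1 : R2 := EuclideanSpace.single 1 1
  have hdX : ∀ y ∈ U, DifferentiableAt ℝ X y := fun y hy =>
    (hX.differentiableOn (by simp)).differentiableAt (hU.mem_nhds hy)
  have hdY : ∀ y ∈ U, DifferentiableAt ℝ Y y := fun y hy =>
    (hY.differentiableOn (by simp)).differentiableAt (hU.mem_nhds hy)
  have hdτ : ∀ y ∈ U, DifferentiableAt ℝ (phase g) y := fun y hy =>
    (hτ.differentiableOn (by simp)).differentiableAt (hU.mem_nhds hy)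
  have main : ∀ w : C2, ∀ y ∈ U, (fderiv ℝ (phase g) y e0 * detC w (Y y)
      + fderiv ℝ (phase g) y e1 * detC (X y) w).re = 0 := by
    intro w
    set p : R2 → ℝ := fun y => (phase g y * detC w (Y y)).re with hpdef
    set q : R2 → ℝ := fun y => (phase g y * detC (X y) w).re with hqdef
    have hp : ContDiffOn ℝ ∞ p U := contDiffOn_re (hτ.mul (ContDiffOn.detC contDiffOn_const hY))
    have hq : ContDiffOn ℝ ∞ q U := contDiffOn_re (hτ.mul (ContDiffOn.detC hX contDiffOn_const))
    -- Since `w` is constant, the divergence of `(p, q)` contains second derivatives of `g` only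
    -- through `det (w, ∂₀Y) + det (∂₁X, w)`, which vanishes by antisymmetry and `∂₀Y = ∂₁X`.
    have hpq : ∀ y ∈ U, fderiv ℝ p y e0 + fderiv ℝ q y e1
        = (fderiv ℝ (phase g) y e0 * detC w (Y y)
          + fderiv ℝ (phase g) y e1 * detC (X y) w).re := by
      intro y hy
      rw [hpdef, hqdef, fderiv_re_mul_detC (hdτ y hy) (differentiableAt_const w) (hdY y hy),
        fderiv_re_mul_detC (hdτ y hy) (hdX y hy) (differentiableAt_const w),
        fderiv_partialD_comm hU hg hy, ← Complex.add_re]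
      congr 1
      simp only [detC, fderiv_fun_const, Pi.zero_apply, zero_apply]
      ring
    have hcont : ContinuousOn (fun y => fderiv ℝ p y e0 + fderiv ℝ q y e1) U :=
      ((hp.continuousOn_fderiv_of_isOpen hU (by simp)).clm_apply continuousOn_const).add
        ((hq.continuousOn_fderiv_of_isOpen hU (by simp)).clm_apply continuousOn_const)
    -- The fundamental lemma of the calculus of variations gives vanishing almost everywhere;
    -- continuity upgrades it to every point of `U`.
    have hae := hU.ae_eq_zero_of_integral_contDiff_smul_eq_zero (μ := volume)
      (hcont.locallyIntegrableOn hU.measurableSet) ?_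
    · have hz : Set.EqOn (fun y => fderiv ℝ p y e0 + fderiv ℝ q y e1) (fun _ => 0) U :=
        Measure.eqOn_open_of_ae_eq ((ae_restrict_iff' hU.measurableSet).2 hae) hU hcont
          continuousOn_const
      intro y hy
      rw [← hpq y hy]
      exact hz hy
    intro φ hφ hφc hφU
    have h0 := (hcrit φ hφ hφc hφU w)
      |>.unique (hasDerivAt_integral_sqrt_gramDet hU hg hD hω hφ hφc hφU w)
    have hint : ∀ y ∈ tsupport φ, 2 * ((starRingEnd ℂ) (jacobian g y) *
        (fderiv ℝ φ y e0 * detC w (Y y) + fderiv ℝ φ y e1 * detC (X y) w)).re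
        / (2 * Real.sqrt (Complex.normSq (jacobian g y)))
        = fderiv ℝ φ y e0 * p y + fderiv ℝ φ y e1 * q y := by
      intro y _
      rw [mul_div_mul_left _ _ two_ne_zero]
      simp only [hpdef, hqdef, phase, Complex.mul_re, Complex.add_re, Complex.add_im,
        Complex.mul_im, Complex.ofReal_re, Complex.ofReal_im, Complex.smul_re, Complex.smul_im,
        smul_eq_mul]
      ring
    rw [setIntegral_congr_fun (isClosed_tsupport φ).measurableSet hint,
      setIntegral_eq_integral_of_forall_compl_eq_zero] at h0
    · obtain ⟨i1, i2, i3⟩ := integral_fderiv_mul_eq hU hφ hφc hφU hp e0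
      obtain ⟨j1, j2, j3⟩ := integral_fderiv_mul_eq hU hφ hφc hφU hq e1
      rw [integral_add i1 j1, i3, j3] at h0
      simp only [smul_eq_mul, mul_add]
      rw [integral_add i2 j2]
      linarith
    · intro y hy
      have : ∀ v, fderiv ℝ φ y v = 0 := fun v => by
        by_contra hne
        exact hy (tsupport_fderiv_apply_subset ℝ v (subset_tsupport _ hne))
      rw [this, this]
      ring
  intro y hy
  -- As `X` and `Y` are complex independent, the equations for all `w` annihilate both partial
  -- derivatives of the phase.
  obtain ⟨h0, h1⟩ := eq_zero_of_re_detC (hD y hy) (fun w => main w y hy)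
  ext v
  have hv : v = v 0 • e0 + v 1 • e1 := by
    ext i
    fin_cases i <;> simp [e0, e1]
  rw [hv, map_add, map_smul, map_smul, h0, h1]
  simp

end


/-! ### From the surface to its charts -/

section ChartExtend

variable {M : Type*} [TopologicalSpace M] {e : OpenPartialHomeomorph M R2}

/-- Extension by zero of a test function defined in the chart `e`. -/
def chartExtend (e : OpenPartialHomeomorph M R2) (φ : R2 → ℝ) (x : M) : ℝ :=
  Set.indicator e.source (φ ∘ e) x

theorem chartExtend_eq_zero {φ : R2 → ℝ} {x : M} (hx : x ∉ e.symm '' tsupport φ) :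
    chartExtend e φ x = 0 := by
  rw [chartExtend, Set.indicator_apply_eq_zero]
  intro hs
  by_contra h
  exact hx ⟨e x, subset_tsupport _ h, e.left_inv hs⟩

theorem chartExtend_symm {φ : R2 → ℝ} {y : R2} (hy : y ∈ e.target) :
    chartExtend e φ (e.symm y) = φ y := by
  rw [chartExtend, Set.indicator_of_mem (e.map_target hy), Function.comp_apply, e.right_inv hy]

end ChartExtend

section Charts

variable {M : Type*} [TopologicalSpace M] [ChartedSpace R2 M]
  {f : M → C2} {e : OpenPartialHomeomorph M R2}

theorem contDiffOn_comp_symm (hf : ContMDiff (𝓡 2) 𝓘(ℝ, C2) ∞ f)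
    (he : e ∈ IsManifold.maximalAtlas (𝓡 2) ∞ M) : ContDiffOn ℝ ∞ (f ∘ e.symm) e.target :=
  (hf.comp_contMDiffOn (contMDiffOn_symm_of_mem_maximalAtlas he)).contDiffOn

theorem mdifferentiable_of_mem_maximalAtlas (he : e ∈ IsManifold.maximalAtlas (𝓡 2) ∞ M) :
    e.MDifferentiable (𝓡 2) (𝓡 2) :=
  ⟨(contMDiffOn_of_mem_maximalAtlas he).mdifferentiableOn (by simp),
    (contMDiffOn_symm_of_mem_maximalAtlas he).mdifferentiableOn (by simp)⟩

theorem fderiv_comp_symm (hf : ContMDiff (𝓡 2) 𝓘(ℝ, C2) ∞ f)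
    (he : e ∈ IsManifold.maximalAtlas (𝓡 2) ∞ M) {y : R2} (hy : y ∈ e.target) (a : R2) :
    fderiv ℝ (f ∘ e.symm) y a
      = mfderiv (𝓡 2) 𝓘(ℝ, C2) f (e.symm y) (mfderiv (𝓡 2) (𝓡 2) e.symm y a) := by
  rw [← mfderiv_eq_fderiv, mfderiv_comp y (hf.mdifferentiableAt (by simp))
    ((mdifferentiable_of_mem_maximalAtlas he).mdifferentiableAt_symm hy)]
  rfl

theorem exists_fderiv_comp_symm (hf : ContMDiff (𝓡 2) 𝓘(ℝ, C2) ∞ f)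
    (he : e ∈ IsManifold.maximalAtlas (𝓡 2) ∞ M) {y : R2} (hy : y ∈ e.target)
    (X : TangentSpace (𝓡 2) (e.symm y)) :
    ∃ a : R2, fderiv ℝ (f ∘ e.symm) y a = mfderiv (𝓡 2) 𝓘(ℝ, C2) f (e.symm y) X := by
  obtain ⟨a, ha⟩ := (mdifferentiable_of_mem_maximalAtlas he).symm.mfderiv_surjective hy X
  exact ⟨a, (fderiv_comp_symm hf he hy a).trans (congrArg _ ha)⟩

theorem IsLagrangian.omega_fderiv (hlag : IsLagrangian f)
    (hf : ContMDiff (𝓡 2) 𝓘(ℝ, C2) ∞ f)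
    (he : e ∈ IsManifold.maximalAtlas (𝓡 2) ∞ M) {y : R2} (hy : y ∈ e.target) (a b : R2) :
    omega (fderiv ℝ (f ∘ e.symm) y a) (fderiv ℝ (f ∘ e.symm) y b) = 0 := by
  rw [fderiv_comp_symm hf he hy, fderiv_comp_symm hf he hy]
  exact hlag _ _ _

theorem IsNondegenerate.eq_zero_of_metric_fderiv (hnd : IsNondegenerate f)
    (hf : ContMDiff (𝓡 2) 𝓘(ℝ, C2) ∞ f)
    (he : e ∈ IsManifold.maximalAtlas (𝓡 2) ∞ M) {y : R2} (hy : y ∈ e.target) {a : R2}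
    (h : ∀ b, metric (fderiv ℝ (f ∘ e.symm) y a) (fderiv ℝ (f ∘ e.symm) y b) = 0) : a = 0 := by
  refine (mdifferentiable_of_mem_maximalAtlas he).symm.mfderiv_injective hy
    (Eq.trans ?_ (map_zero (mfderiv (𝓡 2) (𝓡 2) e.symm y)).symm)
  refine hnd _ _ fun X => ?_
  obtain ⟨b, hb⟩ := exists_fderiv_comp_symm hf he hy X
  rw [inducedMetric, ← hb]
  exact fderiv_comp_symm hf he hy a ▸ h b

theorem fderiv_eq_partialD (g : R2 → C2) (y a : R2) :
    fderiv ℝ g y a = a 0 • partialD g 0 y + a 1 • partialD g 1 y := by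
  have hv : a = a 0 • EuclideanSpace.single 0 (1 : ℝ) + a 1 • EuclideanSpace.single 1 (1 : ℝ) := by
    ext i
    fin_cases i <;> simp
  conv_lhs => rw [hv]
  rw [map_add, map_smul, map_smul]
  rfl

theorem metric_fderiv (g : R2 → C2) (y a b : R2) :
    metric (fderiv ℝ g y a) (fderiv ℝ g y b)
      = b 0 * (a 0 * metric (partialD g 0 y) (partialD g 0 y)
          + a 1 * metric (partialD g 1 y) (partialD g 0 y))
        + b 1 * (a 0 * metric (partialD g 0 y) (partialD g 1 y)
          + a 1 * metric (partialD g 1 y) (partialD g 1 y)) := by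
  rw [fderiv_eq_partialD, fderiv_eq_partialD, metric_comm]
  simp only [metric_add_left, metric_smul_left]
  rw [metric_comm (partialD g 0 y), metric_comm (partialD g 1 y)]
  simp only [metric_add_left, metric_smul_left]

theorem gramDet_ne_zero {g : R2 → C2} {y : R2}
    (h : ∀ a, (∀ b, metric (fderiv ℝ g y a) (fderiv ℝ g y b) = 0) → a = 0) :
    gramDet g y ≠ 0 := by
  intro h0
  rw [gramDet] at h0
  -- If the determinant vanishes, this vector `(g₀₁, -g₀₀)` lies in the kernel of the metric and so
  -- is zero. Then the first basis vector lies in the kernel too.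
  have h1 := h !₂[metric (partialD g 0 y) (partialD g 1 y), - metric (partialD g 0 y) (partialD g 0 y)]
    fun b => by
      rw [metric_fderiv, metric_comm (partialD g 1 y) (partialD g 0 y)]
      rw [metric_comm (partialD g 1 y) (partialD g 0 y)] at h0
      simp
      linear_combination (- b 1) * h0
  have e0 : metric (partialD g 0 y) (partialD g 1 y) = 0 := by simpa using congrArg (· 0) h1
  have e1 : metric (partialD g 0 y) (partialD g 0 y) = 0 := by simpa using congrArg (· 1) h1
  have h2 := h !₂[1, 0] fun b => by
    rw [metric_fderiv]
    simp [e0, e1]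
  simpa using congrArg (· 0) h2

theorem gramDet_eq_neg_normSq {g : R2 → C2} {y : R2}
    (h : omega (partialD g 0 y) (partialD g 1 y) = 0) :
    gramDet g y = - Complex.normSq (jacobian g y) := by
  rw [gramDet, metric_mul_metric_sub, h, jacobian]
  ring

theorem jacobian_comp_symm_ne_zero (hnd : IsNondegenerate f) (hlag : IsLagrangian f)
    (hf : ContMDiff (𝓡 2) 𝓘(ℝ, C2) ∞ f)
    (he : e ∈ IsManifold.maximalAtlas (𝓡 2) ∞ M) {y : R2} (hy : y ∈ e.target) :
    jacobian (f ∘ e.symm) y ≠ 0 := by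
  intro h0
  have h1 := gramDet_ne_zero fun a h => hnd.eq_zero_of_metric_fderiv hf he hy h
  rw [gramDet_eq_neg_normSq (hlag.omega_fderiv hf he hy _ _), h0] at h1
  simp at h1

/-- In a Hausdorff space the compact image of `tsupport φ` is closed. The support of the extension
therefore stays inside the chart, where smoothness is that of `φ ∘ e`. -/
theorem contMDiff_chartExtend [T2Space M] (he : e ∈ IsManifold.maximalAtlas (𝓡 2) ∞ M)
    {φ : R2 → ℝ} (hφ : ContDiff ℝ ∞ φ) (hφc : HasCompactSupport φ) (hφe : tsupport φ ⊆ e.target) :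
    ContMDiff (𝓡 2) 𝓘(ℝ, ℝ) ∞ (chartExtend e φ) := by
  have hK : IsCompact (e.symm '' tsupport φ) :=
    IsCompact.image_of_continuousOn hφc (e.continuousOn_symm.mono hφe)
  refine contMDiff_of_tsupport fun x hx => ?_
  have hx' : x ∈ e.symm '' tsupport φ := by
    refine closure_minimal (fun z hz => ?_) hK.isClosed hx
    by_contra h
    exact hz (chartExtend_eq_zero h)
  obtain ⟨y, hy, rfl⟩ := hx'
  have hs : e.symm y ∈ e.source := e.map_target (hφe hy)
  have h1 : ContMDiffAt (𝓡 2) 𝓘(ℝ, ℝ) ∞ (φ ∘ e) (e.symm y) :=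
    (hφ.contMDiff.contMDiffAt).comp _ (contMDiffAt_of_mem_maximalAtlas he hs)
  refine h1.congr_of_eventuallyEq ?_
  filter_upwards [e.open_source.mem_nhds hs] with z hz
  exact Set.indicator_of_mem hz _

/-- The variation by a bump function times a constant vector moves only points of a compact set
inside one chart. A decomposition into a single piece then computes its volume. -/
theorem IsVolumeCritical.hasDerivAt_integral [T2Space M] (hcrit : IsVolumeCritical f)
    (hf : ContMDiff (𝓡 2) 𝓘(ℝ, C2) ∞ f)
    (he : e ∈ IsManifold.maximalAtlas (𝓡 2) ∞ M)
    {φ : R2 → ℝ} (hφ : ContDiff ℝ ∞ φ) (hφc : HasCompactSupport φ) (hφe : tsupport φ ⊆ e.target)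
    (w : C2) :
    HasDerivAt (fun t : ℝ => ∫ y in tsupport φ,
      Real.sqrt |gramDet (fun y => (f ∘ e.symm) y + (t * φ y) • w) y|) 0 0 := by
  have hK : IsCompact (e.symm '' tsupport φ) :=
    IsCompact.image_of_continuousOn hφc (e.continuousOn_symm.mono hφe)
  have himage : e '' (e.symm '' tsupport φ) = tsupport φ := by
    rw [Set.image_image]
    exact (Set.image_congr fun y hy => e.right_inv (hφe hy)).trans (Set.image_id _)
  have hψ := contMDiff_chartExtend he hφ hφc hφe
  let F : ℝ → M → C2 := fun t x => f x + (t * chartExtend e φ x) • w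
  have hF : IsVariation f (e.symm '' tsupport φ) F := by
    refine ⟨?_, ?_, ?_⟩
    · exact (hf.comp contMDiff_snd).add
        (((contMDiff_fst (M := ℝ) (N := M)).smul (hψ.comp contMDiff_snd)).smul contMDiff_const)
    · funext x
      simp [F]
    · intro t x hx
      simp [F, chartExtend_eq_zero hx]
  let D : ChartDecomposition (e.symm '' tsupport φ) :=
    { card := 1
      chart := fun _ => e
      piece := fun _ => e.symm '' tsupport φ
      chart_mem := fun _ => he
      piece_subset := fun _ => by
        rintro _ ⟨y, hy, rfl⟩
        exact e.map_target (hφe hy)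
      measurable := fun _ => by
        rw [himage]
        exact (isClosed_tsupport φ).measurableSet
      disjoint := fun i j hij => (hij (Subsingleton.elim i j)).elim
      iUnion_eq := Set.iUnion_const _ }
  refine (hcrit _ F hK hF D).congr_of_eventuallyEq (Filter.Eventually.of_forall fun t => ?_)
  simp only [ChartDecomposition.volume, D, Finset.univ_unique, Finset.sum_const,
    Finset.card_singleton, one_smul, chartVolume, himage]
  refine MeasureTheory.setIntegral_congr_fun (isClosed_tsupport φ).measurableSet fun y hy => ?_
  -- The Gram matrix involves derivatives, so agreement is needed on a neighbourhood of `y`.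
  have hev : F t ∘ e.symm =ᶠ[nhds y] fun y => (f ∘ e.symm) y + (t * φ y) • w := by
    filter_upwards [e.open_target.mem_nhds (hφe hy)] with z hz
    simp only [F, Function.comp_apply, chartExtend_symm hz]
  simp only [gram, Matrix.det_fin_two, Matrix.of_apply, hev.fderiv_eq, gramDet, partialD]

/-- In a chart, the phase of a minimal Lagrangian surface has vanishing derivative. -/
theorem fderiv_phase_comp_symm_eq_zero [T2Space M] (hf : IsSmoothImmersion f) (hmin : IsMinimal f)
    (hlag : IsLagrangian f) (he : e ∈ IsManifold.maximalAtlas (𝓡 2) ∞ M) :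
    ∀ y ∈ e.target, fderiv ℝ (phase (f ∘ e.symm)) y = 0 :=
  fderiv_phase_eq_zero e.open_target (contDiffOn_comp_symm hf.1 he)
    (fun _ hy => jacobian_comp_symm_ne_zero hmin.1 hlag hf.1 he hy)
    (fun _ hy => hlag.omega_fderiv hf.1 he hy _ _)
    fun _ hφ hφc hφe w => hmin.2.hasDerivAt_integral hf.1 he hφ hφc hφe w

end Charts


/-! ### The null splitting attached to a phase -/

/-- The first null component of `z` for the splitting of `ℂ²` determined by the phase `c`. -/
def nullA (c : ℂ) : C2 →ₗ[ℝ] ℂ where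
  toFun z := z 0 + c * (starRingEnd ℂ) (z 1)
  map_add' z w := by simp; ring
  map_smul' r z := by simp; ring

/-- The second null component of `z` for the splitting of `ℂ²` determined by the phase `c`. -/
def nullB (c : ℂ) : C2 →ₗ[ℝ] ℂ where
  toFun z := z 0 - c * (starRingEnd ℂ) (z 1)
  map_add' z w := by simp; ring
  map_smul' r z := by simp; ring

/-- The parametrization of the null plane of phase `c`. -/
def nullEmb (c : ℂ) : ℂ →ₗ[ℝ] C2 where
  toFun a := ![a / 2, c * (starRingEnd ℂ) a / 2]
  map_add' a b := by
    ext i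
    fin_cases i <;> simp <;> ring
  map_smul' r a := by
    ext i
    fin_cases i <;> simp <;> ring

theorem nullA_apply (c : ℂ) (z : C2) : nullA c z = z 0 + c * (starRingEnd ℂ) (z 1) := rfl

theorem nullB_apply (c : ℂ) (z : C2) : nullB c z = z 0 - c * (starRingEnd ℂ) (z 1) := rfl

theorem nullEmb_zero (c a : ℂ) : nullEmb c a 0 = a / 2 := rfl

theorem nullEmb_one (c a : ℂ) : nullEmb c a 1 = c * (starRingEnd ℂ) a / 2 := rfl

/-- The totally null plane `{(a, c ā)}`. -/
def nullPlane (c : ℂ) : Submodule ℝ C2 := LinearMap.range (nullEmb c)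

theorem nullEmb_injective (c : ℂ) : Function.Injective (nullEmb c) := by
  intro a b h
  have := congrFun h 0
  rw [nullEmb_zero, nullEmb_zero] at this
  linear_combination 2 * this

theorem mul_conj_of_norm {c : ℂ} (hc : ‖c‖ = 1) : c * (starRingEnd ℂ) c = 1 := by
  rw [Complex.mul_conj, Complex.normSq_eq_norm_sq, hc]
  simp

/-- `J` carries the graph `z₂ = c z̄₁` to the graph `z₂ = -c z̄₁`, and `z` splits along these two.
The factor `-i` compensates the `i` of `J`. -/
theorem eq_nullEmb_add {c : ℂ} (hc : ‖c‖ = 1) (z : C2) :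
    z = nullEmb c (nullA c z) + J (nullEmb c (-Complex.I * nullB c z)) := by
  have h := mul_conj_of_norm hc
  ext i
  fin_cases i
  · simp only [Fin.zero_eta, Pi.add_apply, J_apply, nullEmb_zero, nullA_apply, nullB_apply]
    linear_combination ((1 : ℂ) / 2 * (z 0 - c * (starRingEnd ℂ) (z 1))) * Complex.I_mul_I
  · simp only [Fin.mk_one, Pi.add_apply, J_apply, nullEmb_one, nullA_apply, nullB_apply, map_add,
      map_sub, map_mul, map_neg, Complex.conj_I, Complex.conj_conj]
    linear_combination (-(1 : ℂ) / 2 * c * ((starRingEnd ℂ) (z 0) - (starRingEnd ℂ) c * z 1))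
      * Complex.I_mul_I - z 1 * h

/-- Paired with `detC_eq_null`, where the same two terms appear with a minus sign. If both left-hand
sides vanish, so does each term: the two values of `nullA c` are real-parallel, and likewise those
of `nullB c`. -/
theorem omega_eq_null {c : ℂ} (hc : ‖c‖ = 1) (z w : C2) :
    2 * omega z w = (nullA c z * (starRingEnd ℂ) (nullA c w)).im
      + (nullB c z * (starRingEnd ℂ) (nullB c w)).im := by
  have h := mul_conj_of_norm hc
  have e : nullA c z * (starRingEnd ℂ) (nullA c w) + nullB c z * (starRingEnd ℂ) (nullB c w)
      = 2 * (z 0 * (starRingEnd ℂ) (w 0) + (starRingEnd ℂ) (z 1) * w 1) := by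
    simp only [nullA_apply, nullB_apply, map_add, map_sub, map_mul, Complex.conj_conj]
    linear_combination 2 * (starRingEnd ℂ) (z 1) * w 1 * h
  rw [← Complex.add_im, e]
  simp [omega, herm]
  ring

theorem detC_eq_null (c : ℂ) (z w : C2) :
    2 * ((starRingEnd ℂ) c * detC z w).im = (nullA c z * (starRingEnd ℂ) (nullA c w)).im
      - (nullB c z * (starRingEnd ℂ) (nullB c w)).im := by
  have e : nullA c z * (starRingEnd ℂ) (nullA c w) - nullB c z * (starRingEnd ℂ) (nullB c w)
      = 2 * (z 0 * (starRingEnd ℂ) c * w 1 + c * (starRingEnd ℂ) (z 1 * w 0)) := by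
    simp only [nullA_apply, nullB_apply, map_add, map_sub, map_mul, Complex.conj_conj]
    ring
  rw [← Complex.sub_im, e]
  simp [detC]
  ring

/-- Only mixed products occur, so the kernel of either component is totally null, and neither
component can vanish identically on a non-degenerate tangent plane. -/
theorem metric_eq_null {c : ℂ} (hc : ‖c‖ = 1) (z w : C2) :
    2 * metric z w = -(nullA c z * (starRingEnd ℂ) (nullB c w)).re
      - (nullB c z * (starRingEnd ℂ) (nullA c w)).re := by
  have h := mul_conj_of_norm hc
  have e : nullA c z * (starRingEnd ℂ) (nullB c w) + nullB c z * (starRingEnd ℂ) (nullA c w)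
      = 2 * (z 0 * (starRingEnd ℂ) (w 0) - (starRingEnd ℂ) (z 1) * w 1) := by
    simp only [nullA_apply, nullB_apply, map_add, map_sub, map_mul, Complex.conj_conj]
    linear_combination -2 * (starRingEnd ℂ) (z 1) * w 1 * h
  have e' := congrArg Complex.re e
  rw [Complex.add_re] at e'
  have : metric z w = -(z 0 * (starRingEnd ℂ) (w 0) - (starRingEnd ℂ) (z 1) * w 1).re := by
    simp [metric, herm]
    ring
  rw [this, ← neg_add', e']
  simp
  ring

theorem nullA_nullEmb {c : ℂ} (hc : ‖c‖ = 1) (a : ℂ) : nullA c (nullEmb c a) = a := by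
  have h := mul_conj_of_norm hc
  simp only [nullA_apply, nullEmb_zero, nullEmb_one, map_mul, map_div₀, Complex.conj_conj,
    map_ofNat]
  linear_combination a / 2 * h

theorem nullB_nullEmb {c : ℂ} (hc : ‖c‖ = 1) (a : ℂ) : nullB c (nullEmb c a) = 0 := by
  have h := mul_conj_of_norm hc
  simp only [nullB_apply, nullEmb_zero, nullEmb_one, map_mul, map_div₀, Complex.conj_conj,
    map_ofNat]
  linear_combination -a / 2 * h

theorem nullA_J_nullEmb {c : ℂ} (hc : ‖c‖ = 1) (a : ℂ) : nullA c (J (nullEmb c a)) = 0 := by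
  have h := mul_conj_of_norm hc
  simp only [nullA_apply, J_apply, nullEmb_zero, nullEmb_one, map_mul, map_div₀, Complex.conj_conj,
    map_ofNat, Complex.conj_I]
  linear_combination -Complex.I * a / 2 * h

theorem finrank_nullPlane (c : ℂ) : Module.finrank ℝ (nullPlane c) = 2 := by
  rw [nullPlane, LinearMap.finrank_range_of_inj (nullEmb_injective c), Complex.finrank_real_complex]

theorem isTotallyNull_nullPlane {c : ℂ} (hc : ‖c‖ = 1) : IsTotallyNull (nullPlane c) := by
  rintro _ ⟨a, rfl⟩ _ ⟨b, rfl⟩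
  have := metric_eq_null hc (nullEmb c a) (nullEmb c b)
  simpa [nullB_nullEmb hc] using this

theorem not_isLagrangianPlane_nullPlane {c : ℂ} (hc : ‖c‖ = 1) :
    ¬ IsLagrangianPlane (nullPlane c) := by
  intro h
  have h1 := omega_eq_null hc (nullEmb c Complex.I) (nullEmb c 1)
  rw [h _ ⟨_, rfl⟩ _ ⟨_, rfl⟩, nullA_nullEmb hc, nullB_nullEmb hc, nullA_nullEmb hc] at h1
  simp at h1

theorem isCompl_nullPlane {c : ℂ} (hc : ‖c‖ = 1) :
    IsCompl (nullPlane c) ((nullPlane c).map J) := by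
  constructor
  · rw [Submodule.disjoint_def]
    rintro _ ⟨a, rfl⟩ ⟨_, ⟨b, rfl⟩, hb⟩
    have : a = 0 := by
      rw [← nullA_nullEmb hc a, ← hb]
      exact nullA_J_nullEmb hc b
    rw [this, map_zero]
  · rw [codisjoint_iff, eq_top_iff]
    intro z _
    rw [eq_nullEmb_add hc z]
    exact Submodule.add_mem_sup ⟨_, rfl⟩ ⟨_, ⟨_, rfl⟩, rfl⟩

theorem not_isComplexPlane_nullPlane {c : ℂ} (hc : ‖c‖ = 1) : ¬ IsComplexPlane (nullPlane c) := by
  intro h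
  have h1 := (isCompl_nullPlane hc).disjoint
  rw [show (nullPlane c).map J = nullPlane c from h, disjoint_self] at h1
  have h2 := finrank_nullPlane c
  rw [h1, finrank_bot] at h2
  exact two_ne_zero h2.symm


/-! ### Coordinate rectangles and the inverse function theorem -/

/-- The open coordinate rectangle. -/
def rectangle (a b c d : ℝ) : Set R2 := {y : R2 | y 0 ∈ Set.Ioo a b ∧ y 1 ∈ Set.Ioo c d}

theorem isOpen_rectangle (a b c d : ℝ) : IsOpen (rectangle a b c d) :=
  (isOpen_Ioo.preimage (by fun_prop : Continuous fun y : R2 => y 0)).inter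
    (isOpen_Ioo.preimage (by fun_prop : Continuous fun y : R2 => y 1))

theorem exists_rectangle_subset {V : Set R2} {p : R2} (hV : V ∈ nhds p) :
    ∃ a b c d : ℝ, p ∈ rectangle a b c d ∧ rectangle a b c d ⊆ V := by
  obtain ⟨ε, hε, hball⟩ := Metric.mem_nhds_iff.1 hV
  refine ⟨p 0 - ε / 2, p 0 + ε / 2, p 1 - ε / 2, p 1 + ε / 2, ?_, ?_⟩
  · refine ⟨⟨?_, ?_⟩, ?_, ?_⟩ <;> linarith
  · rintro y ⟨⟨h1, h2⟩, h3, h4⟩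
    refine hball ?_
    rw [Metric.mem_ball, EuclideanSpace.dist_eq, Fin.sum_univ_two, Real.sqrt_lt' hε,
      Real.dist_eq, Real.dist_eq, sq_abs, sq_abs]
    nlinarith

/-- The inverse function theorem, with a smooth inverse on a neighbourhood. -/
theorem exists_smooth_inverse {Φ : R2 → R2} {U : Set R2} (hU : IsOpen U)
    (hΦ : ContDiffOn ℝ ∞ Φ U) {y₀ : R2} (hy₀ : y₀ ∈ U)
    (hinj : ∀ ξ, fderiv ℝ Φ y₀ ξ = 0 → ξ = 0) :
    ∃ Ψ : OpenPartialHomeomorph R2 R2, y₀ ∈ Ψ.source ∧ Ψ.source ⊆ U ∧ ⇑Ψ = Φ ∧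
      ContDiffOn ℝ ∞ Ψ.symm Ψ.target ∧
      ∃ a b c d : ℝ, Ψ.target = rectangle a b c d := by
  have hat : ∀ y ∈ U, ContDiffAt ℝ ∞ Φ y := fun y hy => hΦ.contDiffAt (hU.mem_nhds hy)
  let L : R2 ≃L[ℝ] R2 := (LinearEquiv.ofInjectiveEndo (fderiv ℝ Φ y₀ : R2 →ₗ[ℝ] R2)
    ((injective_iff_map_eq_zero _).2 hinj)).toContinuousLinearEquiv
  have hL : (L : R2 →L[ℝ] R2) = fderiv ℝ Φ y₀ := by
    ext1 ξ
    rfl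
  have hder : HasFDerivAt Φ (L : R2 →L[ℝ] R2) y₀ := by
    rw [hL]
    exact ((hat y₀ hy₀).differentiableAt (by simp)).hasFDerivAt
  let Ψ₀ := (hat y₀ hy₀).toOpenPartialHomeomorph Φ hder (by simp)
  have hcoe : ⇑Ψ₀ = Φ := (hat y₀ hy₀).toOpenPartialHomeomorph_coe hder (by simp)
  have hsrc : y₀ ∈ Ψ₀.source := (hat y₀ hy₀).mem_toOpenPartialHomeomorph_source hder (by simp)
  have hcont : ContinuousAt (fderiv ℝ Φ) y₀ :=
    (hΦ.continuousOn_fderiv_of_isOpen hU (by simp)).continuousAt (hU.mem_nhds hy₀)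
  -- Invertibility of the derivative is an open condition, so the local inverse is smooth on a whole
  -- neighbourhood and not only at the image of `y₀`.
  have hinv : ∀ᶠ y in nhds y₀, y ∈ U ∧
      fderiv ℝ Φ y ∈ Set.range ((↑) : (R2 ≃L[ℝ] R2) → R2 →L[ℝ] R2) := by
    refine (hU.eventually_mem hy₀).and (hcont.eventually ?_)
    rw [← hL]
    exact ContinuousLinearEquiv.nhds L
  obtain ⟨W, hW, hWo, hyW⟩ := eventually_nhds_iff.1 hinv
  have himg : Ψ₀.target ∩ Ψ₀.symm ⁻¹' W ∈ nhds (Φ y₀) := by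
    refine (Ψ₀.isOpen_inter_preimage_symm hWo).mem_nhds ⟨?_, ?_⟩
    · rw [← hcoe]
      exact Ψ₀.map_source hsrc
    · rw [← hcoe, Set.mem_preimage, Ψ₀.left_inv hsrc]
      exact hyW
  obtain ⟨a, b, c, d, hp, hsub⟩ := exists_rectangle_subset himg
  -- Restriction cuts down the source; applied to the inverse, it makes the target of `Ψ` exactly
  -- the rectangle.
  let Ψ := (Ψ₀.symm.restrOpen (rectangle a b c d) (isOpen_rectangle a b c d)).symm
  have htarget : Ψ.target = rectangle a b c d :=
    Set.inter_eq_right.2 fun z hz => (hsub hz).1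
  have hmem : ∀ y ∈ Ψ.source, y ∈ Ψ₀.source ∧ Φ y ∈ rectangle a b c d := by
    intro y hy
    have h := Ψ.map_source hy
    rw [htarget] at h
    exact ⟨hy.1, hcoe ▸ h⟩
  have hsW : ∀ y ∈ Ψ.source, y ∈ W := by
    intro y hy
    have h := (hsub (hmem y hy).2).2
    rw [← hcoe, Set.mem_preimage, Ψ₀.left_inv (hmem y hy).1] at h
    exact h
  refine ⟨Ψ, ⟨hsrc, ?_⟩, fun y hy => (hW y (hsW y hy)).1, hcoe, ?_, a, b, c, d, htarget⟩
  · change Ψ₀ y₀ ∈ rectangle a b c d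
    rw [hcoe]
    exact hp
  · intro z hz
    have hz' : Ψ.symm z ∈ W := hsW _ (Ψ.map_target hz)
    obtain ⟨hzU, E, hE⟩ := hW _ hz'
    refine (Ψ.contDiffAt_symm (f₀' := E) hz ?_ ?_).contDiffWithinAt
    · rw [hE, show ⇑Ψ = Φ from hcoe]
      exact ((hat _ hzU).differentiableAt (by simp)).hasFDerivAt
    · rw [show ⇑Ψ = Φ from hcoe]
      exact hat _ hzU

theorem hasDerivAt_snd_pair (u v : ℝ) :
    HasDerivAt (fun s : ℝ => !₂[u, s]) (EuclideanSpace.single 1 (1 : ℝ)) v := by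
  have e : (fun s : ℝ => !₂[u, s])
      = fun s : ℝ => !₂[u, 0] + s • EuclideanSpace.single 1 (1 : ℝ) := by
    funext s
    ext i
    fin_cases i <;> simp
  rw [e]
  simpa using ((hasDerivAt_id v).smul_const (EuclideanSpace.single 1 (1 : ℝ))).const_add
    !₂[u, (0 : ℝ)]

theorem hasDerivAt_fst_pair (u v : ℝ) :
    HasDerivAt (fun s : ℝ => !₂[s, v]) (EuclideanSpace.single 0 (1 : ℝ)) u := by
  have e : (fun s : ℝ => !₂[s, v])
      = fun s : ℝ => !₂[0, v] + s • EuclideanSpace.single 0 (1 : ℝ) := by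
    funext s
    ext i
    fin_cases i <;> simp
  rw [e]
  simpa using ((hasDerivAt_id u).smul_const (EuclideanSpace.single 0 (1 : ℝ))).const_add
    !₂[(0 : ℝ), v]

theorem contDiff_pair {γ δ : ℝ → ℝ} (hγ : ContDiff ℝ ∞ γ) (hδ : ContDiff ℝ ∞ δ) :
    ContDiff ℝ ∞ fun s : ℝ => !₂[γ s, δ s] := by
  rw [contDiff_euclidean]
  intro i
  fin_cases i
  · exact hγ
  · exact hδ

section Rectangle

variable {a b c d : ℝ} {h : R2 → ℂ} {u u' v v' : ℝ}

theorem hasDerivAt_comp_snd (hh : DifferentiableOn ℝ h (rectangle a b c d))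
    (hu : u ∈ Set.Ioo a b) (hv : v ∈ Set.Ioo c d) :
    HasDerivAt (fun s : ℝ => h !₂[u, s]) (fderiv ℝ h !₂[u, v] (EuclideanSpace.single 1 1)) v :=
  (hh.differentiableAt ((isOpen_rectangle a b c d).mem_nhds
    ⟨hu, hv⟩)).hasFDerivAt.comp_hasDerivAt v (hasDerivAt_snd_pair u v)

theorem hasDerivAt_comp_fst (hh : DifferentiableOn ℝ h (rectangle a b c d))
    (hu : u ∈ Set.Ioo a b) (hv : v ∈ Set.Ioo c d) :
    HasDerivAt (fun s : ℝ => h !₂[s, v]) (fderiv ℝ h !₂[u, v] (EuclideanSpace.single 0 1)) u :=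
  (hh.differentiableAt ((isOpen_rectangle a b c d).mem_nhds
    ⟨hu, hv⟩)).hasFDerivAt.comp_hasDerivAt u (hasDerivAt_fst_pair u v)

/-- On a rectangle, a smooth function is constant in the second variable if its derivative in that
direction vanishes. -/
theorem eq_of_fderiv_single_one (hh : DifferentiableOn ℝ h (rectangle a b c d))
    (h0 : ∀ z ∈ rectangle a b c d, fderiv ℝ h z (EuclideanSpace.single 1 1) = 0)
    (hu : u ∈ Set.Ioo a b) (hv : v ∈ Set.Ioo c d) (hv' : v' ∈ Set.Ioo c d) :
    h !₂[u, v] = h !₂[u, v'] :=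
  isOpen_Ioo.is_const_of_deriv_eq_zero isPreconnected_Ioo (f := fun s : ℝ => h !₂[u, s])
    (fun _ hs => (hasDerivAt_comp_snd hh hu hs).differentiableAt.differentiableWithinAt)
    (fun _ hs => (hasDerivAt_comp_snd hh hu hs).deriv.trans (h0 _ ⟨hu, hs⟩)) hv hv'

/-- On a rectangle, a smooth function is constant in the first variable if its derivative in that
direction vanishes. -/
theorem eq_of_fderiv_single_zero (hh : DifferentiableOn ℝ h (rectangle a b c d))
    (h0 : ∀ z ∈ rectangle a b c d, fderiv ℝ h z (EuclideanSpace.single 0 1) = 0)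
    (hu : u ∈ Set.Ioo a b) (hu' : u' ∈ Set.Ioo a b) (hv : v ∈ Set.Ioo c d) :
    h !₂[u, v] = h !₂[u', v] :=
  isOpen_Ioo.is_const_of_deriv_eq_zero isPreconnected_Ioo (f := fun s : ℝ => h !₂[s, v])
    (fun _ hs => (hasDerivAt_comp_fst hh hs hv).differentiableAt.differentiableWithinAt)
    (fun _ hs => (hasDerivAt_comp_fst hh hs hv).deriv.trans (h0 _ ⟨hs, hv⟩)) hu hu'

end Rectangle


/-! ### Separation of variables -/

/-- The first hypothesis makes `r` a real multiple of `s`. As `s` has a non-zero component along `α`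
and `r` has none, the multiple is zero. This is how rank one is exploited. -/
theorem eq_zero_of_im_mul_conj {α r s : ℂ} (hrs : (r * (starRingEnd ℂ) s).im = 0)
    (hs : ((starRingEnd ℂ) α * s).re ≠ 0) (hr : ((starRingEnd ℂ) α * r).re = 0) : r = 0 := by
  have hs0 : s ≠ 0 := by
    rintro rfl
    simp at hs
  have e : (r * (starRingEnd ℂ) s).re * ((starRingEnd ℂ) α * s).re
      = Complex.normSq s * ((starRingEnd ℂ) α * r).re
        + (r * (starRingEnd ℂ) s).im * ((starRingEnd ℂ) α * s).im := by
    simp only [Complex.mul_re, Complex.mul_im, Complex.conj_re, Complex.conj_im,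
      Complex.normSq_apply]
    ring
  rw [hr, hrs, mul_zero, zero_mul, add_zero] at e
  have h0 : r * (starRingEnd ℂ) s = 0 :=
    Complex.ext ((mul_eq_zero.1 e).resolve_right hs) hrs
  exact (mul_eq_zero.1 h0).resolve_right ((map_ne_zero _).2 hs0)

/-- The derivative of `y ↦ Re (ᾱ k(y))`. -/
theorem hasFDerivAt_re_conj_mul {k : R2 → ℂ} {z : R2} (hk : DifferentiableAt ℝ k z) (α : ℂ) :
    HasFDerivAt (fun y => ((starRingEnd ℂ) α * k y).re)
      (Complex.reCLM.comp ((starRingEnd ℂ) α • fderiv ℝ k z)) z :=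
  Complex.reCLM.hasFDerivAt.comp z (hk.hasFDerivAt.const_mul _)

/-- If the real functional `Re (ᾱ k)` is a coordinate function, its derivative is known. -/
theorem re_conj_mul_fderiv {k : R2 → ℂ} {V : Set R2} (hV : IsOpen V) (hk : DifferentiableOn ℝ k V)
    {α : ℂ} {i : Fin 2} (hcoord : ∀ z ∈ V, ((starRingEnd ℂ) α * k z).re = z i) {z : R2}
    (hz : z ∈ V) (ξ : R2) : ((starRingEnd ℂ) α * fderiv ℝ k z ξ).re = ξ i := by
  have h1 := hasFDerivAt_re_conj_mul (hk.differentiableAt (hV.mem_nhds hz)) α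
  have h2 : HasFDerivAt (fun y : R2 => y i) (EuclideanSpace.proj i : R2 →L[ℝ] ℝ) z :=
    (EuclideanSpace.proj i : R2 →L[ℝ] ℝ).hasFDerivAt
  have h3 := h1.unique (h2.congr_of_eventuallyEq
    (Filter.eventually_of_mem (hV.mem_nhds hz) hcoord))
  have h4 := congrArg (fun T : R2 →L[ℝ] ℝ => T ξ) h3
  simpa using h4

theorem nullA_fderiv {g : R2 → C2} {y : R2} (hg : DifferentiableAt ℝ g y) (c : ℂ) (ξ : R2) :
    fderiv ℝ (fun y => nullA c (g y)) y ξ = nullA c (fderiv ℝ g y ξ) := by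
  have h : HasFDerivAt (fun y => nullA c (g y)) _ y :=
    (LinearMap.toContinuousLinearMap (nullA c)).hasFDerivAt.comp y hg.hasFDerivAt
  rw [h.fderiv]
  rfl

theorem nullB_fderiv {g : R2 → C2} {y : R2} (hg : DifferentiableAt ℝ g y) (c : ℂ) (ξ : R2) :
    fderiv ℝ (fun y => nullB c (g y)) y ξ = nullB c (fderiv ℝ g y ξ) := by
  have h : HasFDerivAt (fun y => nullB c (g y)) _ y :=
    (LinearMap.toContinuousLinearMap (nullB c)).hasFDerivAt.comp y hg.hasFDerivAt
  rw [h.fderiv]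
  rfl

/-- A product structure for a map whose two null components have derivatives of rank one. -/
theorem exists_product_chart {U : Set R2} (hU : IsOpen U) {g : R2 → C2} (hg : ContDiffOn ℝ ∞ g U)
    {y₀ : R2} (hy₀ : y₀ ∈ U) {c : ℂ} (hc : ‖c‖ = 1)
    (hω : ∀ y ∈ U, ∀ ξ η, omega (fderiv ℝ g y ξ) (fderiv ℝ g y η) = 0)
    (hdet : ∀ y ∈ U, ∀ ξ η, ((starRingEnd ℂ) c * detC (fderiv ℝ g y ξ) (fderiv ℝ g y η)).im = 0)
    (hnd : ∀ ξ, (∀ η, metric (fderiv ℝ g y₀ ξ) (fderiv ℝ g y₀ η) = 0) → ξ = 0) :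
    ∃ (a₁ b₁ a₂ b₂ : ℝ) (γ₁ γ₂ : ℝ → C2) (Ψ : OpenPartialHomeomorph R2 R2),
      ContDiffOn ℝ ∞ γ₁ (Set.Ioo a₁ b₁) ∧ ContDiffOn ℝ ∞ γ₂ (Set.Ioo a₂ b₂) ∧
      (∀ u ∈ Set.Ioo a₁ b₁, deriv γ₁ u ≠ 0) ∧ (∀ v ∈ Set.Ioo a₂ b₂, deriv γ₂ v ≠ 0) ∧
      (∀ u, γ₁ u ∈ nullPlane c) ∧ (∀ v, γ₂ v ∈ nullPlane c) ∧
      y₀ ∈ Ψ.source ∧ Ψ.source ⊆ U ∧ ContDiffOn ℝ ∞ Ψ Ψ.source ∧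
      ContDiffOn ℝ ∞ Ψ.symm Ψ.target ∧ Ψ.target = rectangle a₁ b₁ a₂ b₂ ∧
      ∀ z ∈ Ψ.target, g (Ψ.symm z) = γ₁ (z 0) + J (γ₂ (z 1)) := by
  have hgd : ∀ y ∈ U, DifferentiableAt ℝ g y := fun y hy =>
    (hg.differentiableOn (by simp)).differentiableAt (hU.mem_nhds hy)
  have hA : ContDiffOn ℝ ∞ (fun y => nullA c (g y)) U :=
    (LinearMap.toContinuousLinearMap (nullA c)).contDiff.comp_contDiffOn hg
  have hB : ContDiffOn ℝ ∞ (fun y => nullB c (g y)) U :=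
    (LinearMap.toContinuousLinearMap (nullB c)).contDiff.comp_contDiffOn hg
  have hrank : ∀ y ∈ U, ∀ ξ η,
      (nullA c (fderiv ℝ g y ξ) * (starRingEnd ℂ) (nullA c (fderiv ℝ g y η))).im = 0 ∧
      (nullB c (fderiv ℝ g y ξ) * (starRingEnd ℂ) (nullB c (fderiv ℝ g y η))).im = 0 := by
    intro y hy ξ η
    have h1 := omega_eq_null hc (fderiv ℝ g y ξ) (fderiv ℝ g y η)
    have h2 := detC_eq_null c (fderiv ℝ g y ξ) (fderiv ℝ g y η)
    rw [hω y hy] at h1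
    rw [hdet y hy] at h2
    constructor <;> linarith
  have hnt : ∃ ξ : R2, ξ ≠ 0 := ⟨EuclideanSpace.single 0 1, by simp⟩
  -- Were this component of the differential zero, `metric_eq_null` would make the induced metric
  -- vanish at `y₀`.
  obtain ⟨ξ₁, hξ₁⟩ : ∃ ξ, nullA c (fderiv ℝ g y₀ ξ) ≠ 0 := by
    by_contra! h
    obtain ⟨ξ, hξ⟩ := hnt
    refine hξ (hnd ξ fun η => ?_)
    have := metric_eq_null hc (fderiv ℝ g y₀ ξ) (fderiv ℝ g y₀ η)
    rw [h, h] at this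
    simpa using this
  obtain ⟨ξ₂, hξ₂⟩ : ∃ ξ, nullB c (fderiv ℝ g y₀ ξ) ≠ 0 := by
    by_contra! h
    obtain ⟨ξ, hξ⟩ := hnt
    refine hξ (hnd ξ fun η => ?_)
    have := metric_eq_null hc (fderiv ℝ g y₀ ξ) (fderiv ℝ g y₀ η)
    rw [h, h] at this
    simpa using this
  set α := nullA c (fderiv ℝ g y₀ ξ₁)
  set β := nullB c (fderiv ℝ g y₀ ξ₂)
  have hself : ∀ ζ : ℂ, ζ ≠ 0 → ((starRingEnd ℂ) ζ * ζ).re ≠ 0 := by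
    intro ζ hζ
    rw [mul_comm, Complex.mul_conj, Complex.ofReal_re]
    exact (Complex.normSq_pos.2 hζ).ne'
  -- At `y₀` the two null components of the differential take values in the real lines of `α` and
  -- `β`. Projecting onto these lines thus loses nothing to first order, and `Φ` is a local
  -- diffeomorphism.
  let Φ : R2 → R2 := fun y =>
    !₂[((starRingEnd ℂ) α * nullA c (g y)).re, ((starRingEnd ℂ) β * nullB c (g y)).re]
  have hΦ : ContDiffOn ℝ ∞ Φ U := by
    rw [contDiffOn_euclidean]
    intro i
    fin_cases i
    · exact contDiffOn_re (contDiffOn_const.mul hA)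
    · exact contDiffOn_re (contDiffOn_const.mul hB)
  have hinj : ∀ ξ, fderiv ℝ Φ y₀ ξ = 0 → ξ = 0 := by
    intro ξ hξ
    have hΦd : HasFDerivAt Φ (fderiv ℝ Φ y₀) y₀ :=
      ((hΦ.differentiableOn (by simp)).differentiableAt (hU.mem_nhds hy₀)).hasFDerivAt
    have hcomp : ∀ i, HasFDerivAt (fun y => Φ y i)
        ((EuclideanSpace.proj i : R2 →L[ℝ] ℝ).comp (fderiv ℝ Φ y₀)) y₀ := fun i =>
      (EuclideanSpace.proj i : R2 →L[ℝ] ℝ).hasFDerivAt.comp y₀ hΦd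
    have h0 : ((starRingEnd ℂ) α * nullA c (fderiv ℝ g y₀ ξ)).re = 0 := by
      have h1 := hasFDerivAt_re_conj_mul
        ((hA.differentiableOn (by simp)).differentiableAt (hU.mem_nhds hy₀)) α
      have h2 := congrArg (fun T : R2 →L[ℝ] ℝ => T ξ) ((hcomp 0).unique h1)
      simp only [ContinuousLinearMap.comp_apply, hξ, map_zero] at h2
      rw [← nullA_fderiv (hgd y₀ hy₀)]
      exact h2.symm
    have h1 : ((starRingEnd ℂ) β * nullB c (fderiv ℝ g y₀ ξ)).re = 0 := by
      have h1 := hasFDerivAt_re_conj_mul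
        ((hB.differentiableOn (by simp)).differentiableAt (hU.mem_nhds hy₀)) β
      have h2 := congrArg (fun T : R2 →L[ℝ] ℝ => T ξ) ((hcomp 1).unique h1)
      simp only [ContinuousLinearMap.comp_apply, hξ, map_zero] at h2
      rw [← nullB_fderiv (hgd y₀ hy₀)]
      exact h2.symm
    have hA0 := eq_zero_of_im_mul_conj (hrank y₀ hy₀ ξ ξ₁).1 (hself α hξ₁) h0
    have hB0 := eq_zero_of_im_mul_conj (hrank y₀ hy₀ ξ ξ₂).2 (hself β hξ₂) h1
    refine hnd ξ fun η => ?_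
    have := metric_eq_null hc (fderiv ℝ g y₀ ξ) (fderiv ℝ g y₀ η)
    rw [hA0, hB0] at this
    simpa using this
  obtain ⟨Ψ, hyΨ, hΨU, hcoe, hΨs, a₁, b₁, a₂, b₂, htar⟩ := exists_smooth_inverse hU hΦ hy₀ hinj
  have hmapU : Set.MapsTo Ψ.symm (rectangle a₁ b₁ a₂ b₂) U := fun z hz =>
    hΨU (Ψ.map_target (htar ▸ hz))
  rw [htar] at hΨs
  have hh : ContDiffOn ℝ ∞ (fun z => g (Ψ.symm z)) (rectangle a₁ b₁ a₂ b₂) := hg.comp hΨs hmapU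
  have hopen := isOpen_rectangle a₁ b₁ a₂ b₂
  set k : R2 → ℂ := fun z => nullA c (g (Ψ.symm z))
  set l : R2 → ℂ := fun z => nullB c (g (Ψ.symm z))
  have hk : ContDiffOn ℝ ∞ k (rectangle a₁ b₁ a₂ b₂) := hA.comp hΨs hmapU
  have hl : ContDiffOn ℝ ∞ l (rectangle a₁ b₁ a₂ b₂) := hB.comp hΨs hmapU
  have hkd := hk.differentiableOn (by simp)
  have hld := hl.differentiableOn (by simp)
  have hchain : ∀ z ∈ rectangle a₁ b₁ a₂ b₂, ∀ ξ,
      fderiv ℝ k z ξ = nullA c (fderiv ℝ g (Ψ.symm z) (fderiv ℝ Ψ.symm z ξ)) ∧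
      fderiv ℝ l z ξ = nullB c (fderiv ℝ g (Ψ.symm z) (fderiv ℝ Ψ.symm z ξ)) := by
    intro z hz ξ
    have h1 := (hΨs.differentiableOn (by simp)).differentiableAt (hopen.mem_nhds hz)
    have h2 := hgd _ (hmapU hz)
    have h3 : fderiv ℝ (fun z => g (Ψ.symm z)) z ξ
        = fderiv ℝ g (Ψ.symm z) (fderiv ℝ Ψ.symm z ξ) := by
      have : HasFDerivAt (fun z => g (Ψ.symm z)) _ z := h2.hasFDerivAt.comp z h1.hasFDerivAt
      rw [this.fderiv]
      rfl
    have h4 := (hh.differentiableOn (by simp)).differentiableAt (hopen.mem_nhds hz)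
    exact ⟨by rw [← h3]; exact nullA_fderiv h4 c ξ, by rw [← h3]; exact nullB_fderiv h4 c ξ⟩
  have hright : ∀ z ∈ rectangle a₁ b₁ a₂ b₂, Φ (Ψ.symm z) = z := fun z hz => by
    rw [← hcoe]
    exact Ψ.right_inv (htar ▸ hz)
  have hkc := fun z (hz : z ∈ rectangle a₁ b₁ a₂ b₂) ξ =>
    re_conj_mul_fderiv hopen hkd (α := α) (i := 0)
      (fun z hz => congrArg (fun y : R2 => y 0) (hright z hz)) hz ξ
  have hlc := fun z (hz : z ∈ rectangle a₁ b₁ a₂ b₂) ξ =>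
    re_conj_mul_fderiv hopen hld (α := β) (i := 1)
      (fun z hz => congrArg (fun y : R2 => y 1) (hright z hz)) hz ξ
  -- In the new coordinates `Re (ᾱ k) = z 0`, so the parallel vectors `∂₀k` and `∂₁k` have `Re (ᾱ
  -- ·)` equal to `1` and `0`; hence `∂₁k = 0`.
  have hk1 : ∀ z ∈ rectangle a₁ b₁ a₂ b₂, fderiv ℝ k z (EuclideanSpace.single 1 1) = 0 := by
    intro z hz
    refine eq_zero_of_im_mul_conj (α := α) (s := fderiv ℝ k z (EuclideanSpace.single 0 1)) ?_ ?_ ?_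
    · rw [(hchain z hz _).1, (hchain z hz _).1]
      exact (hrank _ (hmapU hz) _ _).1
    · rw [hkc z hz]
      simp
    · rw [hkc z hz]
      simp
  have hl0 : ∀ z ∈ rectangle a₁ b₁ a₂ b₂, fderiv ℝ l z (EuclideanSpace.single 0 1) = 0 := by
    intro z hz
    refine eq_zero_of_im_mul_conj (α := β) (s := fderiv ℝ l z (EuclideanSpace.single 1 1)) ?_ ?_ ?_
    · rw [(hchain z hz _).2, (hchain z hz _).2]
      exact (hrank _ (hmapU hz) _ _).2
    · rw [hlc z hz]
      simp
    · rw [hlc z hz]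
      simp
  obtain ⟨hu₀, hv₀⟩ : Ψ y₀ ∈ rectangle a₁ b₁ a₂ b₂ := htar ▸ Ψ.map_source hyΨ
  set u₀ := Ψ y₀ 0
  set v₀ := Ψ y₀ 1
  let N := LinearMap.toContinuousLinearMap (nullEmb c)
  have hNne : ∀ ζ : ℂ, ζ ≠ 0 → N ζ ≠ 0 := fun ζ hζ h =>
    hζ (nullEmb_injective c (h.trans (map_zero _).symm))
  -- The curves are read off on the coordinate lines through `Ψ y₀`. They are regular because `Re (ᾱ
  -- k)` and `Re (β̄ l)` have unit speed along them.
  refine ⟨a₁, b₁, a₂, b₂, fun u => N (k !₂[u, v₀]), fun v => N (-Complex.I * l !₂[u₀, v]), Ψ,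
    ?_, ?_, ?_, ?_, fun u => ⟨_, rfl⟩, fun v => ⟨_, rfl⟩, hyΨ, hΨU, ?_, htar ▸ hΨs, htar, ?_⟩
  · exact N.contDiff.comp_contDiffOn
      (hk.comp (contDiff_pair contDiff_id contDiff_const).contDiffOn fun u hu => ⟨hu, hv₀⟩)
  · exact N.contDiff.comp_contDiffOn (contDiffOn_const.mul
      (hl.comp (contDiff_pair contDiff_const contDiff_id).contDiffOn fun v hv => ⟨hu₀, hv⟩))
  · intro u hu
    have hder : HasDerivAt (fun u => N (k !₂[u, v₀])) _ u :=
      N.hasFDerivAt.comp_hasDerivAt u (hasDerivAt_comp_fst hkd hu hv₀)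
    rw [hder.deriv]
    refine hNne _ fun h => ?_
    have := hkc !₂[u, v₀] ⟨hu, hv₀⟩ (EuclideanSpace.single 0 1)
    rw [h] at this
    simp at this
  · intro v hv
    have hder : HasDerivAt (fun v => N (-Complex.I * l !₂[u₀, v])) _ v :=
      N.hasFDerivAt.comp_hasDerivAt v ((hasDerivAt_comp_snd hld hu₀ hv).const_mul (-Complex.I))
    rw [hder.deriv]
    refine hNne _ (mul_ne_zero (neg_ne_zero.2 Complex.I_ne_zero) fun h => ?_)
    have := hlc !₂[u₀, v] ⟨hu₀, hv⟩ (EuclideanSpace.single 1 1)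
    rw [h] at this
    simp at this
  · rw [hcoe]
    exact hΦ.mono hΨU
  · intro z hz
    rw [htar] at hz
    have ez : z = !₂[z 0, z 1] := by
      ext i
      fin_cases i <;> rfl
    have e1 : k !₂[z 0, v₀] = k z := by
      conv_rhs => rw [ez]
      exact eq_of_fderiv_single_one hkd hk1 hz.1 hv₀ hz.2
    have e2 : l !₂[u₀, z 1] = l z := by
      conv_rhs => rw [ez]
      exact eq_of_fderiv_single_zero hld hl0 hu₀ hz.1 hz.2
    change _ = nullEmb c (k !₂[z 0, v₀]) + J (nullEmb c (-Complex.I * l !₂[u₀, z 1]))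
    rw [e1, e2]
    exact eq_nullEmb_add hc _


/-! ### One phase on each connected component -/

theorem detC_fderiv (g : R2 → C2) (y a b : R2) :
    detC (fderiv ℝ g y a) (fderiv ℝ g y b)
      = ((a 0 * b 1 - a 1 * b 0 : ℝ) : ℂ) * jacobian g y := by
  rw [fderiv_eq_partialD, fderiv_eq_partialD g y b, detC_smul_add_smul, jacobian]

/-- A change of real frame multiplies the complex determinant by a real number, possibly negative.
The phase is thus intrinsic only up to sign, and the vanishing of an imaginary part is the condition
that survives. -/
theorem im_mul_phase_eq_zero_iff {g : R2 → C2} {y : R2} (hD : jacobian g y ≠ 0) (c : ℂ) :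
    (c * phase g y).im = 0 ↔
      ∀ a b, ((starRingEnd ℂ) c * detC (fderiv ℝ g y a) (fderiv ℝ g y b)).im = 0 := by
  have hpos := Real.sqrt_pos.2 (Complex.normSq_pos.2 hD)
  have e : (c * phase g y).im = -((Real.sqrt (Complex.normSq (jacobian g y)))⁻¹
      * ((starRingEnd ℂ) c * jacobian g y).im) := by
    simp only [phase, Complex.mul_im, Complex.smul_re, Complex.smul_im, Complex.conj_re,
      Complex.conj_im, smul_eq_mul]
    ring
  rw [e, neg_eq_zero, mul_eq_zero, or_iff_right (inv_pos.2 hpos).ne']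
  constructor
  · intro h a b
    rw [detC_fderiv, mul_left_comm, Complex.im_ofReal_mul, h, mul_zero]
  · intro h
    simpa [detC_fderiv] using h (EuclideanSpace.single 0 1) (EuclideanSpace.single 1 1)

section Surface

variable {M : Type*} [TopologicalSpace M] [ChartedSpace R2 M]

/-- The set of points at which the complex determinant of the tangent plane is a real multiple
of `c`. -/
def phaseSet (f : M → C2) (c : ℂ) : Set M :=
  {x | ∀ X Y : TangentSpace (𝓡 2) x, ((starRingEnd ℂ) c *
    detC (mfderiv (𝓡 2) 𝓘(ℝ, C2) f x X) (mfderiv (𝓡 2) 𝓘(ℝ, C2) f x Y)).im = 0}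

variable {f : M → C2} {e : OpenPartialHomeomorph M R2}

theorem symm_mem_phaseSet_iff (hf : ContMDiff (𝓡 2) 𝓘(ℝ, C2) ∞ f)
    (he : e ∈ IsManifold.maximalAtlas (𝓡 2) ∞ M) {y : R2} (hy : y ∈ e.target) (c : ℂ) :
    e.symm y ∈ phaseSet f c ↔ ∀ a b, ((starRingEnd ℂ) c *
      detC (fderiv ℝ (f ∘ e.symm) y a) (fderiv ℝ (f ∘ e.symm) y b)).im = 0 := by
  constructor
  · intro h a b
    rw [fderiv_comp_symm hf he hy, fderiv_comp_symm hf he hy]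
    exact h _ _
  · intro h X Y
    obtain ⟨a, ha⟩ := exists_fderiv_comp_symm hf he hy X
    obtain ⟨b, hb⟩ := exists_fderiv_comp_symm hf he hy Y
    rw [← ha, ← hb]
    exact h a b

variable [IsManifold (𝓡 2) ∞ M]

theorem exists_mem_phaseSet (hf : IsSmoothImmersion f) (hmin : IsMinimal f)
    (hlag : IsLagrangian f) (x : M) : ∃ c : ℂ, ‖c‖ = 1 ∧ x ∈ phaseSet f c := by
  set e := chartAt R2 x
  have he : e ∈ IsManifold.maximalAtlas (𝓡 2) ∞ M := IsManifold.chart_mem_maximalAtlas x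
  have hx : x ∈ e.source := mem_chart_source R2 x
  have hD := jacobian_comp_symm_ne_zero hmin.1 hlag hf.1 he (e.map_source hx)
  set D := jacobian (f ∘ e.symm) (e x)
  -- With this `c`, the product `c̄D = |D|` is real.
  refine ⟨D / ‖D‖, ?_, ?_⟩
  · rw [norm_div, Complex.norm_real, norm_norm, div_self (norm_ne_zero_iff.2 hD)]
  · rw [← e.left_inv hx, symm_mem_phaseSet_iff hf.1 he (e.map_source hx)]
    intro a b
    rw [detC_fderiv, mul_left_comm, map_div₀, Complex.conj_ofReal, div_mul_eq_mul_div,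
      mul_comm _ (jacobian _ _), Complex.mul_conj, ← Complex.ofReal_div, ← Complex.ofReal_mul,
      Complex.ofReal_im]

variable [T2Space M]

/-- In a chart, membership depends only on the phase, which is constant on a coordinate ball. The
equivalence makes both the set and its complement open. -/
theorem eventually_mem_phaseSet_iff (hf : IsSmoothImmersion f) (hmin : IsMinimal f)
    (hlag : IsLagrangian f) (c : ℂ) (x : M) :
    ∀ᶠ z in nhds x, z ∈ phaseSet f c ↔ x ∈ phaseSet f c := by
  set e := chartAt R2 x
  have he : e ∈ IsManifold.maximalAtlas (𝓡 2) ∞ M := IsManifold.chart_mem_maximalAtlas x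
  have hx : x ∈ e.source := mem_chart_source R2 x
  have hD : ∀ y ∈ e.target, jacobian (f ∘ e.symm) y ≠ 0 := fun y hy =>
    jacobian_comp_symm_ne_zero hmin.1 hlag hf.1 he hy
  have key : ∀ z ∈ e.source, z ∈ phaseSet f c ↔ (c * phase (f ∘ e.symm) (e z)).im = 0 := by
    intro z hz
    rw [im_mul_phase_eq_zero_iff (hD _ (e.map_source hz)),
      ← symm_mem_phaseSet_iff hf.1 he (e.map_source hz), e.left_inv hz]
  obtain ⟨ε, hε, hball⟩ := Metric.isOpen_iff.1 e.open_target _ (e.map_source hx)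
  have hdiff : DifferentiableOn ℝ (phase (f ∘ e.symm)) (Metric.ball (e x) ε) :=
    ((contDiffOn_phase e.open_target (contDiffOn_comp_symm hf.1 he) hD).differentiableOn
      (by simp)).mono hball
  have hev : ∀ᶠ z in nhds x, e z ∈ Metric.ball (e x) ε :=
    (e.continuousAt hx).eventually (Metric.ball_mem_nhds _ hε)
  filter_upwards [hev, e.open_source.mem_nhds hx] with z hz hzs
  rw [key z hzs, key x hx, Metric.isOpen_ball.is_const_of_fderiv_eq_zero
    (convex_ball _ _).isPreconnected hdiff
    (fun y hy => fderiv_phase_comp_symm_eq_zero hf hmin hlag he y (hball hy)) hz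
    (Metric.mem_ball_self hε)]

theorem isClopen_phaseSet (hf : IsSmoothImmersion f) (hmin : IsMinimal f)
    (hlag : IsLagrangian f) (c : ℂ) : IsClopen (phaseSet f c) := by
  refine ⟨⟨isOpen_iff_mem_nhds.2 fun x hx => ?_⟩, isOpen_iff_mem_nhds.2 fun x hx => ?_⟩
  · filter_upwards [eventually_mem_phaseSet_iff hf hmin hlag c x] with z hz
    exact fun h => hx (hz.1 h)
  · filter_upwards [eventually_mem_phaseSet_iff hf hmin hlag c x] with z hz
    exact hz.2 hx

theorem isLocalProductAt_of_mem_phaseSet (hf : IsSmoothImmersion f) (hmin : IsMinimal f)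
    (hlag : IsLagrangian f) {c : ℂ} (hc : ‖c‖ = 1) {x : M} (hxc : x ∈ phaseSet f c) :
    IsLocalProductAt f (nullPlane c) x := by
  set e := chartAt R2 x
  have he : e ∈ IsManifold.maximalAtlas (𝓡 2) ∞ M := IsManifold.chart_mem_maximalAtlas x
  have hx : x ∈ e.source := mem_chart_source R2 x
  -- Openness of the phase set spreads the determinant condition from `x` to a neighbourhood, as the
  -- rank argument requires.
  have hUo : IsOpen (e.target ∩ e.symm ⁻¹' phaseSet f c) :=
    e.isOpen_inter_preimage_symm (isClopen_phaseSet hf hmin hlag c).isOpen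
  obtain ⟨a₁, b₁, a₂, b₂, γ₁, γ₂, Ψ, h1, h2, h3, h4, h5, h6, hyΨ, hΨU, hΨ, hΨs, htar, hprod⟩ :=
    exists_product_chart hUo
      ((contDiffOn_comp_symm hf.1 he).mono Set.inter_subset_left)
      (y₀ := e x) ⟨e.map_source hx, by rwa [Set.mem_preimage, e.left_inv hx]⟩ hc
      (fun y hy => hlag.omega_fderiv hf.1 he hy.1)
      (fun y hy => (symm_mem_phaseSet_iff hf.1 he hy.1 c).1 hy.2)
      (fun ξ h => hmin.1.eq_zero_of_metric_fderiv hf.1 he (e.map_source hx) h)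
  have hsub : Ψ.source ⊆ e.target := hΨU.trans Set.inter_subset_left
  have htarget : (e.trans Ψ).target = Ψ.target := by
    rw [OpenPartialHomeomorph.trans_target]
    exact Set.inter_eq_left.2 fun z hz => hsub (Ψ.map_target hz)
  refine ⟨a₁, b₁, a₂, b₂, γ₁, γ₂, e.trans Ψ, h1, h2, h3, h4, fun u _ => h5 u, fun v _ => h6 v,
    OpenPartialHomeomorph.mem_maximalAtlas_of_contMDiffOn _ ?_ ?_, ?_, htarget.trans htar, ?_⟩
  · rw [OpenPartialHomeomorph.trans_source]
    exact hΨ.contMDiffOn.comp ((contMDiffOn_of_mem_maximalAtlas he).mono Set.inter_subset_left)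
      Set.inter_subset_right
  · rw [htarget]
    exact (contMDiffOn_symm_of_mem_maximalAtlas he).comp hΨs.contMDiffOn
      fun z hz => hsub (Ψ.map_target hz)
  · rw [OpenPartialHomeomorph.trans_source]
    exact ⟨hx, hyΨ⟩
  · intro z hz
    exact hprod z (htarget ▸ hz)

end Surface

end LorentzianPlane

end

open LorentzianPlane in
theorem mainTheorem2 {M : Type*} [TopologicalSpace M] [T2Space M] [SecondCountableTopology M]
    [ChartedSpace R2 M] [IsManifold (𝓡 2) ∞ M] (f : M → C2)
    (hf : IsSmoothImmersion f) (hmin : IsMinimal f) (hlag : IsLagrangian f) (x₀ : M) :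
    ∃ P : Submodule ℝ C2,
      Module.finrank ℝ P = 2 ∧ IsTotallyNull P ∧ ¬ IsLagrangianPlane P ∧ ¬ IsComplexPlane P ∧
      IsCompl P (P.map J) ∧
      ∀ x ∈ connectedComponent x₀, IsLocalProductAt f P x := by
  obtain ⟨c, hc, hx₀⟩ := exists_mem_phaseSet hf hmin hlag x₀
  exact ⟨nullPlane c, finrank_nullPlane c, isTotallyNull_nullPlane hc,
    not_isLagrangianPlane_nullPlane hc, not_isComplexPlane_nullPlane hc, isCompl_nullPlane hc,
    fun x hx => isLocalProductAt_of_mem_phaseSet hf hmin hlag hc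
      ((isClopen_phaseSet hf hmin hlag c).connectedComponent_subset hx₀ hx)⟩
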